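/- **Setting.** A *propositional coherent theory* $\mathbb T$ is a Grothendieck fibration $p:\mathbb T_1\to\mathbb T_0$ with preorder fibres over a category with finite products ("topes over cubes") which has *coherent tope logic*: the fibres have finite meets and finite joins, meets distribute over joins, all these are stable under reindexing, and there are equality topes $x\equiv y$ over $I\times I$ (reflexive, and allowing substitution in topes). A *strict interval* in $\mathbb T$ is a cube $\mathbb 2$ with points $0,1:\mathbf 1\to\mathbb 2$ and a tope $x\le y$ over $\mathbb 2\times\mathbb 2$ that is provably reflexive, transitive, antisymmetric and total, with $0\le x$, $x\le 1$, and $0\equiv 1\vdash\bot$. A *finitary model category with $\mathbb T$-shapes* $(\mathcal M,\mathcal V,\mathbb T,\overline\omega)$ consists of: (1) a right proper model structure $\mathcal M$ on a finitely (co)complete category which is an elementary topos, whose cofibrations are exactly the monomorphisms; (2) a propositional coherent theory $\mathbb T$ and a model of it in a coherent category $\mathcal V$, that is, functors $m_0:\mathbb T_0\to\mathcal V$ and $m_1:\mathbb T_1\to\mathrm{Mono}(\mathcal V)$ with $\mathrm{cod}\circ m_1=m_0\circ p$, such that $m_0$ preserves finite products, and $m_1$ preserves cartesian morphisms and, fibrewise,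 finite meets and joins; (3) a functor $\overline\omega:\mathcal V\to\mathcal M$ preserving finite limits, regular epimorphisms and finite unions of subobjects; such that (4) for every $U\in\mathcal V$ the functor $\overline\omega(U)\times-$ takes acyclic cofibrations to weak equivalences. A *comprehension category with shapes* consists of a fibration $\mathbb T_1\to\mathbb T_0$ of preorders over a category with finite products, a fibration $\mathcal C\to\mathbb T_1$ (contexts) with stable fibrewise terminal objects, and a comprehension category $\mathcal Ty\to\mathcal C^{\to}$ over $\mathcal C$ whose display maps $\Gamma.A\to\Gamma$ lie over identities of $\mathbb T_1$. A term of a type $A$ over $\Gamma$ after a substitution $\sigma:\Delta\to\Gamma$ is a map $\Delta\to\Gamma.A$ over $\sigma$. For a shape $\psi\in\mathbb T_1$, write $\Gamma.\psi$ for the reindexing of $\Gamma$ along the projection to its tope context $\Phi$ from the product $\Phi\times\psi$ in $\mathbb T_1$. * *Type eliminations for tope disjunction*: if the tope context of $\Gamma$ is $\bot$, then each type over $\Gamma$ has exactly one term; if it entails $\varphi\vee\psi$, then terms of a type over $\Gamma$ on the restrictions of $\Gamma$ to $\varphi$ and to $\psi$ that agree on $\varphi\wedge\psi$ extend to exactly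 one term over $\Gamma$. * *Extension type* of $(\Gamma,A,a)$, for $\varphi\le\psi$ over a cube $I$, $A$ a type over $\Gamma.\psi$ and $a$ a term of $A$ on $\Gamma.\varphi$: a type $E$ over $\Gamma$ with a term of $A$ on $(\Gamma.E).\psi$ restricting to $a$ on $\varphi$, which is universal: for every $\sigma:\Delta\to\Gamma$, terms of $E$ after $\sigma$ correspond bijectively to terms of $A$ on $\Delta.\psi$ that restrict to $a$ on $\Delta.\varphi$. *Pseudo-stable extension types*: a choice of extension types for all such data, with a functorial choice of cartesian morphisms of types, compatible with the universal terms, from the extension type of reindexed data to that of the original data. * *Relative function extensionality*: if $A$ is contractible over $\Gamma.\psi$, then the extension type $E$ is contractible over $\Gamma$. Here $A$ over $\Gamma$ is contractible if for some identity type of $A$ (a type over $\Gamma.A\times_\Gamma\Gamma.A$ with a reflexivity term satisfying the elimination rule stably under substitution) there are a term $c$ of $A$ and, over $\Gamma.A$ with variable $x$, a term of $\mathrm{Id}(c,x)$. Let $R:\mathbb T_1\to\mathcal M$ send a tope to $\overline\omega$ of the domain of its image under $m_1$. The *induced comprehension category with shapes* has the cubes and topes of $\mathbb T$; its contexts over $\Phi$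 are maps $\Gamma\to R(\Phi)$ in $\mathcal M$ from a class $P$ of context maps, its types over $\Gamma$ are fibrations $A\to\Gamma$, and context extension is $\Gamma.A=A$. Here $P$ may be any class of maps that contains the fibrations and the identities and is closed under composition and base change (for example all maps, or the fibrations). **Theorem.** Let $(\mathcal M,\mathcal V,\mathbb T,\overline\omega)$ be a finitary model category with $\mathbb T$-shapes. For every such class $P$, the induced comprehension category with shapes has pseudo-stable coherent tope logic with type eliminations for tope disjunction, and pseudo-stable extension types satisfying relative function extensionality. Consequently, if $\mathbb T$ has a strict interval, then it models simplicial homotopy type theory (up to strictification), in the sense that it has all of this structure together with a strict interval in its tope layer. -/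

import Mathlib

open CategoryTheory CategoryTheory.Limits HomotopicalAlgebra

attribute [-instance] CategoryTheory.catToReflQuiver

namespace SimplicialTT

/-! ## Topes: fibrations in preorders and coherent logic without quantifiers -/

section Topes

universe v₀ u₀ v₁ u₁

variable {T₀ : Type u₀} [Category.{v₀} T₀] {T₁ : Type u₁} [Category.{v₁} T₁]

/-- The topes in the cube context `I`: the objects of the fibre of `p : T₁ ⥤ T₀` over `I`. -/
abbrev Tope (p : T₁ ⥤ T₀) (I : T₀) := p.Fiber I

/-- `Entails p f θ φ` says that `θ ⊢ φ[f]`: there is a morphism from `θ` to `φ` over `f`. -/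
def Entails (p : T₁ ⥤ T₀) {J I : T₀} (f : J ⟶ I) (θ : Tope p J) (φ : Tope p I) : Prop :=
  ∃ g : θ.1 ⟶ φ.1, p.IsHomLift f g

/-- `φ'` is the reindexing of the tope `φ` along `f`. -/
def IsReindexing (p : T₁ ⥤ T₀) {J I : T₀} (f : J ⟶ I) (φ' : Tope p J) (φ : Tope p I) : Prop :=
  ∃ g : φ'.1 ⟶ φ.1, p.IsStronglyCartesian f g

/-- The entailment preorder on the topes in a given cube context. -/
instance topePreorder (p : T₁ ⥤ T₀) (I : T₀) : Preorder (Tope p I) where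
  le φ ψ := Nonempty (φ ⟶ ψ)
  le_refl φ := ⟨𝟙 φ⟩
  le_trans _ _ _ f g := ⟨f.some ≫ g.some⟩

variable [HasFiniteProducts T₀]

/-- `E` is the equality tope `x ≡ y` in the cube context `x : I, y : I`: it is reflexive, and
it satisfies substitution of equals in topes (with an arbitrary cube `K` of parameters). -/
structure IsEqualityTope (p : T₁ ⥤ T₀) {I : T₀} (E : Tope p (I ⨯ I)) : Prop where
  refl : ∀ {J : T₀} (s : J ⟶ I) (θ : Tope p J), Entails p (prod.lift s s) θ E
  subst : ∀ {J K : T₀} (r : J ⟶ K) (s t : J ⟶ I) (θ : Tope p J) (φ : Tope p (K ⨯ I)),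
    Entails p (prod.lift s t) θ E → Entails p (prod.lift r s) θ φ → Entails p (prod.lift r t) θ φ

/-- Coherent tope logic: the fibres have finite meets and finite joins, meets distribute over
joins, all of these are stable under reindexing, and there are equality topes. -/
structure CoherentTopeLogic (p : T₁ ⥤ T₀) : Prop where
  exists_top : ∀ I : T₀, ∃ χ : Tope p I, IsTop χ
  exists_bot : ∀ I : T₀, ∃ χ : Tope p I, IsBot χ
  exists_meet : ∀ {I : T₀} (φ ψ : Tope p I), ∃ χ, IsGLB {φ, ψ} χ
  exists_join : ∀ {I : T₀} (φ ψ : Tope p I), ∃ χ, IsLUB {φ, ψ} χ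
  distrib : ∀ {I : T₀} {θ φ ψ χ α β δ : Tope p I}, IsLUB {φ, ψ} χ → IsGLB {θ, χ} δ →
    IsGLB {θ, φ} α → IsGLB {θ, ψ} β → IsLUB {α, β} δ
  top_stable : ∀ {J I : T₀} (f : J ⟶ I) {χ' : Tope p J} {χ : Tope p I},
    IsReindexing p f χ' χ → IsTop χ → IsTop χ'
  bot_stable : ∀ {J I : T₀} (f : J ⟶ I) {χ' : Tope p J} {χ : Tope p I},
    IsReindexing p f χ' χ → IsBot χ → IsBot χ'
  meet_stable : ∀ {J I : T₀} (f : J ⟶ I) {φ' ψ' χ' : Tope p J} {φ ψ χ : Tope p I},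
    IsReindexing p f φ' φ → IsReindexing p f ψ' ψ → IsReindexing p f χ' χ →
    IsGLB {φ, ψ} χ → IsGLB {φ', ψ'} χ'
  join_stable : ∀ {J I : T₀} (f : J ⟶ I) {φ' ψ' χ' : Tope p J} {φ ψ χ : Tope p I},
    IsReindexing p f φ' φ → IsReindexing p f ψ' ψ → IsReindexing p f χ' χ →
    IsLUB {φ, ψ} χ → IsLUB {φ', ψ'} χ'
  exists_equality : ∀ I : T₀, ∃ E : Tope p (I ⨯ I), IsEqualityTope p E

/-- A propositional coherent theory: a Grothendieck fibration of topes over a category of cubes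
with finite products, whose fibres are preorders (for a fibration this is faithfulness), with
coherent tope logic. -/
structure PropositionalCoherentTheory (p : T₁ ⥤ T₀) : Prop where
  fibered : p.IsFibered
  faithful : p.Faithful
  coherent : CoherentTopeLogic p

/-- A strict interval: a cube `two` with points `zero` and `one` and a tope `x ≤ y`, which is
a total order with least element `zero` and greatest element `one`, such that
`zero ≡ one` entails `⊥`. -/
structure StrictInterval (p : T₁ ⥤ T₀) where
  two : T₀
  zero : ⊤_ T₀ ⟶ two
  one : ⊤_ T₀ ⟶ two
  le : Tope p (two ⨯ two)
  le_refl : ∀ {J : T₀} (x : J ⟶ two) (θ : Tope p J), Entails p (prod.lift x x) θ le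
  le_trans : ∀ {J : T₀} (x y z : J ⟶ two) (θ : Tope p J), Entails p (prod.lift x y) θ le →
    Entails p (prod.lift y z) θ le → Entails p (prod.lift x z) θ le
  le_antisymm : ∀ {J : T₀} (x y : J ⟶ two) (θ : Tope p J) (E : Tope p (two ⨯ two)),
    IsEqualityTope p E → Entails p (prod.lift x y) θ le → Entails p (prod.lift y x) θ le →
    Entails p (prod.lift x y) θ E
  le_total : ∀ ge χ : Tope p (two ⨯ two), IsReindexing p (prod.lift prod.snd prod.fst) ge le →
    IsLUB {le, ge} χ → IsTop χ
  zero_le : ∀ {J : T₀} (x : J ⟶ two) (θ : Tope p J),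
    Entails p (prod.lift (terminal.from J ≫ zero) x) θ le
  le_one : ∀ {J : T₀} (x : J ⟶ two) (θ : Tope p J),
    Entails p (prod.lift x (terminal.from J ≫ one)) θ le
  zero_ne_one : ∀ {J : T₀} (θ : Tope p J) (E : Tope p (two ⨯ two)), IsEqualityTope p E →
    Entails p (prod.lift (terminal.from J ≫ zero) (terminal.from J ≫ one)) θ E → IsBot θ

end Topes

/-! ## Comprehension categories with shapes -/

section ComprehensionCategories

universe v₀ u₀ v₁ u₁ v₂ u₂ v₃ u₃

/-- A comprehension category with shapes.  Its three layers are a fibration in preorders `tope`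
of tope contexts over cube contexts, a fibration `ctx` of type contexts over tope contexts with
(stable) empty contexts, and a comprehension category over the category of type contexts: a
fibration `typ` of types with a context extension `ext` and display maps `π` (together: a functor
from types to arrows of contexts, over contexts) which takes cartesian morphisms to pullback
squares.  Extending a context by a type does not change the cube and tope contexts. -/
structure CompCatWithShapes (T₀ : Type u₀) [Category.{v₀} T₀] (T₁ : Type u₁) [Category.{v₁} T₁]
    (C : Type u₂) [Category.{v₂} C] (Ty : Type u₃) [Category.{v₃} Ty] where
  tope : T₁ ⥤ T₀
  ctx : C ⥤ T₁
  typ : Ty ⥤ C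
  ext : Ty ⥤ C
  π : ext ⟶ typ
  cubes_products : HasFiniteProducts T₀
  tope_fibered : tope.IsFibered
  tope_faithful : tope.Faithful
  ctx_fibered : ctx.IsFibered
  exists_empty : ∀ Φ : T₁, ∃ X : C, ctx.obj X = Φ ∧
    ∀ (Y : C) (f : ctx.obj Y ⟶ Φ), ∃! g : Y ⟶ X, ctx.IsHomLift f g
  typ_fibered : typ.IsFibered
  π_vertical : ∀ A : Ty, ctx.IsHomLift (𝟙 (ctx.obj (typ.obj A))) (π.app A)
  π_cartesian : ∀ {A B : Ty} (f : A ⟶ B), typ.IsStronglyCartesian (typ.map f) f →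
    IsPullback (ext.map f) (π.app A) (π.app B) (typ.map f)

namespace CompCatWithShapes

variable {T₀ : Type u₀} [Category.{v₀} T₀] {T₁ : Type u₁} [Category.{v₁} T₁]
  {C : Type u₂} [Category.{v₂} C] {Ty : Type u₃} [Category.{v₃} Ty]

section Basic

variable (K : CompCatWithShapes T₀ T₁ C Ty)

/-- The cube context of a context. -/
abbrev cube (Γ : C) : T₀ := K.tope.obj (K.ctx.obj Γ)

/-- The tope context of a context, as a tope over its cube context. -/
def shape (Γ : C) : Tope K.tope (K.cube Γ) := ⟨K.ctx.obj Γ, rfl⟩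

/-- The types in context `Γ`. -/
abbrev TypeIn (Γ : C) := K.typ.Fiber Γ

/-- The extension of `Γ` by the type `A`. -/
abbrev extend {Γ : C} (A : K.TypeIn Γ) : C := K.ext.obj A.1

/-- The display map of a type.  A term of the type `A` after the substitution `σ : Δ ⟶ Γ` is
a morphism `Δ ⟶ K.extend A` whose composite with `K.proj A` is `σ`. -/
def proj {Γ : C} (A : K.TypeIn Γ) : K.extend A ⟶ Γ := K.π.app A.1 ≫ eqToHom A.2

end Basic

/-! ### Type eliminations for tope disjunction -/

/-- `g : Γ' ⟶ Γ` exhibits `Γ'` as the restriction of `Γ` to the tope `α` (in the same cubes). -/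
structure IsRestriction (K : CompCatWithShapes T₀ T₁ C Ty) {Γ' Γ : C} (g : Γ' ⟶ Γ)
    (α : Tope K.tope (K.cube Γ)) : Prop where
  shape_eq : K.ctx.obj Γ' = α.1
  vertical : K.tope.IsHomLift (𝟙 (K.cube Γ)) (K.ctx.map g)
  cartesian : K.ctx.IsStronglyCartesian (K.ctx.map g) g

/-- Eliminations of tope disjunctions into types.  Nullary case: if the tope context of `Γ` is
`⊥`, then every type in context `Γ` has exactly one term.  Binary case: if the tope context of
`Γ` entails `φ ∨ ψ`, then terms of `A` over the restrictions of `Γ` to `φ` and to `ψ` which agree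
over the restriction to `φ ∧ ψ` come from exactly one term of `A` over `Γ`. -/
structure HasTopeDisjunctionElim (K : CompCatWithShapes T₀ T₁ C Ty) : Prop where
  bot_elim : ∀ (Γ : C), IsBot (K.shape Γ) → ∀ A : K.TypeIn Γ,
    ∃! z : Γ ⟶ K.extend A, z ≫ K.proj A = 𝟙 Γ
  join_elim : ∀ (Γ : C) (φ ψ χ α β δ : Tope K.tope (K.cube Γ)),
    IsLUB {φ, ψ} χ → K.shape Γ ≤ χ →
    IsGLB {K.shape Γ, φ} α → IsGLB {K.shape Γ, ψ} β → IsGLB {α, β} δ →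
    ∀ {Γα Γβ Γδ : C} (gα : Γα ⟶ Γ) (gβ : Γβ ⟶ Γ) (gδ : Γδ ⟶ Γ) (kα : Γδ ⟶ Γα) (kβ : Γδ ⟶ Γβ),
    K.IsRestriction gα α → K.IsRestriction gβ β → K.IsRestriction gδ δ →
    kα ≫ gα = gδ → kβ ≫ gβ = gδ →
    ∀ (A : K.TypeIn Γ) (x : Γα ⟶ K.extend A) (y : Γβ ⟶ K.extend A),
    x ≫ K.proj A = gα → y ≫ K.proj A = gβ → kα ≫ x = kβ ≫ y →
    ∃! z : Γ ⟶ K.extend A, z ≫ K.proj A = 𝟙 Γ ∧ gα ≫ z = x ∧ gβ ≫ z = y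

/-! ### Extension types -/

/-- The extension `Γ, t : I | ψ` of a context `Γ` over `Ξ | Φ` by a shape `{t : I | ψ}`: the
reindexing of `Γ` along the projection `(Ξ, t : I | Φ ∧ ψ) ⟶ (Ξ | Φ)`.  In the category of tope
contexts `(Ξ, t : I | Φ ∧ ψ)` is the product of `(Ξ | Φ)` and `(t : I | ψ)`. -/
structure ShapeExtension (K : CompCatWithShapes T₀ T₁ C Ty) (Γ : C) (ψ : T₁) where
  obj : C
  wk : obj ⟶ Γ
  var : K.ctx.obj obj ⟶ ψ
  isProduct : IsLimit (BinaryFan.mk (K.ctx.map wk) var)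
  cartesian : K.ctx.IsStronglyCartesian (K.ctx.map wk) wk

namespace ShapeExtension

variable {K : CompCatWithShapes T₀ T₁ C Ty} {Γ Δ : C} {φ ψ : T₁}

lemma lift_aux (G : K.ShapeExtension Γ ψ) (x : Δ ⟶ Γ) (y : K.ctx.obj Δ ⟶ ψ) :
    K.ctx.map x = G.isProduct.lift (BinaryFan.mk (K.ctx.map x) y) ≫ K.ctx.map G.wk :=
  (G.isProduct.fac (BinaryFan.mk (K.ctx.map x) y) ⟨WalkingPair.left⟩).symm

/-- The substitution `Δ ⟶ Γ, t : I | ψ` with components `x : Δ ⟶ Γ` and `y`. -/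
noncomputable def lift (G : K.ShapeExtension Γ ψ) (x : Δ ⟶ Γ) (y : K.ctx.obj Δ ⟶ ψ) :
    Δ ⟶ G.obj :=
  haveI := G.cartesian
  Functor.IsStronglyCartesian.map K.ctx (K.ctx.map G.wk) G.wk (G.lift_aux x y) x

@[simp]
lemma lift_wk (G : K.ShapeExtension Γ ψ) (x : Δ ⟶ Γ) (y : K.ctx.obj Δ ⟶ ψ) :
    G.lift x y ≫ G.wk = x :=
  have := G.cartesian
  Functor.IsStronglyCartesian.fac K.ctx (K.ctx.map G.wk) G.wk (G.lift_aux x y) x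

@[simp]
lemma map_lift_var (G : K.ShapeExtension Γ ψ) (x : Δ ⟶ Γ) (y : K.ctx.obj Δ ⟶ ψ) :
    K.ctx.map (G.lift x y) ≫ G.var = y := by
  have := G.cartesian
  have h : K.ctx.IsHomLift (G.isProduct.lift (BinaryFan.mk (K.ctx.map x) y)) (G.lift x y) :=
    Functor.IsStronglyCartesian.map_isHomLift K.ctx (K.ctx.map G.wk) G.wk (G.lift_aux x y) x
  have e := IsHomLift.eq_of_isHomLift K.ctx
    (G.isProduct.lift (BinaryFan.mk (K.ctx.map x) y)) (G.lift x y)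
  rw [← e]
  exact G.isProduct.fac (BinaryFan.mk (K.ctx.map x) y) ⟨WalkingPair.right⟩

/-- The substitution `Δ, t : I | ψ ⟶ Γ, t : I | ψ` induced by `σ : Δ ⟶ Γ`. -/
noncomputable def map (D : K.ShapeExtension Δ ψ) (G : K.ShapeExtension Γ ψ) (σ : Δ ⟶ Γ) :
    D.obj ⟶ G.obj :=
  G.lift (D.wk ≫ σ) D.var

/-- The substitution `Γ, t : I | φ ⟶ Γ, t : I | ψ` induced by an entailment `φ ⊢ ψ`. -/
noncomputable def incl (G : K.ShapeExtension Γ φ) (G' : K.ShapeExtension Γ ψ) (j : φ ⟶ ψ) :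
    G.obj ⟶ G'.obj :=
  G'.lift G.wk (G.var ≫ j)

end ShapeExtension

/-- The premises of the formation of an extension type `⟨Π (t : I | ψ), A t | φ ↦ a⟩` for shapes
`φ ⊢ ψ` over the cube `I`: a context `Γ`, a type `A` in context `Γ, t : I | ψ`, and a term
`a` of `A` in context `Γ, t : I | φ`. -/
structure ExtensionProblem (K : CompCatWithShapes T₀ T₁ C Ty) {I : T₀} {φ ψ : Tope K.tope I}
    (j : φ ⟶ ψ) where
  base : C
  big : K.ShapeExtension base ψ.1
  small : K.ShapeExtension base φ.1
  A : K.TypeIn big.obj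
  a : small.obj ⟶ K.extend A
  a_proj : a ≫ K.proj A = small.incl big j.1

namespace ExtensionProblem

variable {K : CompCatWithShapes T₀ T₁ C Ty} {I : T₀} {φ ψ : Tope K.tope I} {j : φ ⟶ ψ}

/-- `b` is a term of `A`, after the substitution `σ : Δ ⟶ Γ`, in context `Δ, t : I | ψ`, which
restricts to `a` on `φ`. -/
structure IsSolution (d : K.ExtensionProblem j) {Δ : C} (σ : Δ ⟶ d.base)
    (D : K.ShapeExtension Δ ψ.1) (b : D.obj ⟶ K.extend d.A) : Prop where
  proj : b ≫ K.proj d.A = D.map d.big σ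
  restrict : ∀ D' : K.ShapeExtension Δ φ.1,
    D'.incl D j.1 ≫ b = D'.map d.small σ ≫ d.a

/-- A morphism of extension problems: a substitution `σ` together with a cartesian morphism of
types over it that is compatible with the given partial terms, so that the source is the
reindexing of the target along `σ`. -/
structure IsHom (d' d : K.ExtensionProblem j) (σ : d'.base ⟶ d.base) (α : d'.A.1 ⟶ d.A.1) :
    Prop where
  cartesian : K.typ.IsStronglyCartesian (d'.big.map d.big σ) α
  term : d'.a ≫ K.ext.map α = d'.small.map d.small σ ≫ d.a

end ExtensionProblem

/-- An extension type: a type `E` in context `Γ` with a universal solution `ev` (application),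
so that terms of `E` after any substitution `σ : Δ ⟶ Γ` correspond bijectively, via `ev`, to terms
of `A` in context `Δ, t : I | ψ` which restrict to `a` on `φ`. -/
structure ExtensionType {K : CompCatWithShapes T₀ T₁ C Ty} {I : T₀} {φ ψ : Tope K.tope I}
    {j : φ ⟶ ψ} (d : K.ExtensionProblem j) where
  E : K.TypeIn d.base
  dom : K.ShapeExtension (K.extend E) ψ.1
  ev : dom.obj ⟶ K.extend d.A
  ev_isSolution : d.IsSolution (K.proj E) dom ev
  universal : ∀ {Δ : C} (σ : Δ ⟶ d.base) (D : K.ShapeExtension Δ ψ.1)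
    (b : D.obj ⟶ K.extend d.A), d.IsSolution σ D b →
    ∃! s : Δ ⟶ K.extend E, s ≫ K.proj E = σ ∧ D.map dom s ≫ ev = b

/-- Pseudo-stable extension types: a choice of extension types for all premises, together with
a functorial choice of cartesian morphisms of types, compatible with application, from the
extension type of a reindexed extension problem to the extension type of the original one. -/
structure PseudoStableExtensionTypes (K : CompCatWithShapes T₀ T₁ C Ty) where
  type : ∀ {I : T₀} {φ ψ : Tope K.tope I} {j : φ ⟶ ψ} (d : K.ExtensionProblem j), ExtensionType d
  map : ∀ {I : T₀} {φ ψ : Tope K.tope I} {j : φ ⟶ ψ} {d' d : K.ExtensionProblem j}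
    {σ : d'.base ⟶ d.base} {α : d'.A.1 ⟶ d.A.1}, d'.IsHom d σ α →
    ((type d').E.1 ⟶ (type d).E.1)
  map_cartesian : ∀ {I : T₀} {φ ψ : Tope K.tope I} {j : φ ⟶ ψ} {d' d : K.ExtensionProblem j}
    {σ : d'.base ⟶ d.base} {α : d'.A.1 ⟶ d.A.1} (h : d'.IsHom d σ α),
    K.typ.IsStronglyCartesian σ (map h)
  map_ev : ∀ {I : T₀} {φ ψ : Tope K.tope I} {j : φ ⟶ ψ} {d' d : K.ExtensionProblem j}
    {σ : d'.base ⟶ d.base} {α : d'.A.1 ⟶ d.A.1} (h : d'.IsHom d σ α),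
    (type d').dom.map (type d).dom (K.ext.map (map h)) ≫ (type d).ev =
      (type d').ev ≫ K.ext.map α
  map_id : ∀ {I : T₀} {φ ψ : Tope K.tope I} {j : φ ⟶ ψ} {d : K.ExtensionProblem j}
    (h : d.IsHom d (𝟙 d.base) (𝟙 d.A.1)), map h = 𝟙 (type d).E.1
  map_comp : ∀ {I : T₀} {φ ψ : Tope K.tope I} {j : φ ⟶ ψ} {d'' d' d : K.ExtensionProblem j}
    {σ' : d''.base ⟶ d'.base} {α' : d''.A.1 ⟶ d'.A.1} {σ : d'.base ⟶ d.base}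
    {α : d'.A.1 ⟶ d.A.1} (h' : d''.IsHom d' σ' α') (h : d'.IsHom d σ α)
    (h'' : d''.IsHom d (σ' ≫ σ) (α' ≫ α)), map h'' = map h' ≫ map h

/-! ### Identity types, contractibility, relative function extensionality -/

/-- `r : X ⟶ Y` over `Γ` satisfies (stable) type elimination: after every substitution
`σ : Δ ⟶ Γ`, a term over `X` of a type `B` over `Y` extends to a term of `B` over `Y`. -/
def IsEliminator (K : CompCatWithShapes T₀ T₁ C Ty) {X Y Γ : C} (r : X ⟶ Y) (y : Y ⟶ Γ) : Prop :=
  ∀ {Δ X' Y' : C} (σ : Δ ⟶ Γ) (xf : X' ⟶ X) (xs : X' ⟶ Δ) (yf : Y' ⟶ Y) (ys : Y' ⟶ Δ),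
    IsPullback xf xs (r ≫ y) σ → IsPullback yf ys y σ →
    ∀ r' : X' ⟶ Y', r' ≫ yf = xf ≫ r → r' ≫ ys = xs →
    ∀ (B : K.TypeIn Y') (b : X' ⟶ K.extend B), b ≫ K.proj B = r' →
    ∃ e : Y' ⟶ K.extend B, e ≫ K.proj B = 𝟙 Y' ∧ r' ≫ e = b

/-- An identity type of `A`: a type `Id` in context `Γ, x : A, y : A` with reflexivity terms
`refl`, which satisfy the elimination rule. -/
structure IdentityType (K : CompCatWithShapes T₀ T₁ C Ty) {Γ : C} (A : K.TypeIn Γ) where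
  pairs : C
  fst : pairs ⟶ K.extend A
  snd : pairs ⟶ K.extend A
  isPullback : IsPullback fst snd (K.proj A) (K.proj A)
  Id : K.TypeIn pairs
  refl : K.extend A ⟶ K.extend Id
  refl_fst : refl ≫ K.proj Id ≫ fst = 𝟙 _
  refl_snd : refl ≫ K.proj Id ≫ snd = 𝟙 _
  elim : K.IsEliminator refl (K.proj Id ≫ fst ≫ K.proj A)

/-- The type `A` in context `Γ` is contractible: it has a term `c` and, in context `Γ, x : A`,
a term of the identity type `Id c x` (that is, `isContr A` is inhabited in context `Γ`). -/
def IsContractible (K : CompCatWithShapes T₀ T₁ C Ty) {Γ : C} (A : K.TypeIn Γ) : Prop :=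
  ∃ (i : K.IdentityType A) (c : Γ ⟶ K.extend A) (h : K.extend A ⟶ K.extend i.Id),
    c ≫ K.proj A = 𝟙 Γ ∧ h ≫ K.proj i.Id ≫ i.fst = K.proj A ≫ c ∧
      h ≫ K.proj i.Id ≫ i.snd = 𝟙 _

/-- Relative function extensionality: if each `A t` (for `t : I | ψ`) is contractible, then so is
each extension type `⟨Π (t : I | ψ), A t | φ ↦ a⟩`. -/
def PseudoStableExtensionTypes.RelativeFunext {K : CompCatWithShapes T₀ T₁ C Ty}
    (X : K.PseudoStableExtensionTypes) : Prop :=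
  ∀ {I : T₀} {φ ψ : Tope K.tope I} {j : φ ⟶ ψ} (d : K.ExtensionProblem j),
    K.IsContractible d.A → K.IsContractible (X.type d).E

/-- The tope layer of `K` has (pseudo-stable) coherent tope logic. -/
def HasCoherentTopeLogic (K : CompCatWithShapes T₀ T₁ C Ty) : Prop :=
  haveI := K.cubes_products
  CoherentTopeLogic K.tope

/-- `K` models simplicial homotopy type theory (up to strictification): it has pseudo-stable
coherent tope logic with a strict interval and with type eliminations for tope disjunction, and
pseudo-stable extension types satisfying relative function extensionality. -/
structure ModelsSHoTT (K : CompCatWithShapes T₀ T₁ C Ty) : Prop where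
  coherent : K.HasCoherentTopeLogic
  interval : haveI := K.cubes_products; Nonempty (StrictInterval K.tope)
  disjunctionElim : K.HasTopeDisjunctionElim
  extensionTypes : ∃ X : K.PseudoStableExtensionTypes, X.RelativeFunext

end CompCatWithShapes

end ComprehensionCategories

/-! ## Finitary model categories with shapes -/

section ModelCategories

universe v₀ u₀ v₁ u₁ v u w' w

/-- Elementary toposes: finite limits, exponentials, a subobject classifier. -/
class ElementaryTopos (M : Type u) [Category.{v} M] : Prop where
  hasFiniteLimits : HasFiniteLimits M
  cartesianClosed : ∀ X : M, (prod.functor.obj X).IsLeftAdjoint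
  hasClassifier : HasSubobjectClassifier M

/-- Coherent categories: regular categories with finite unions of subobjects, stable under
pullback. -/
class CoherentCategory (V : Type u) [Category.{v} V] : Prop extends Regular V where
  exists_bot : ∀ X : V, ∃ S : Subobject X, IsBot S
  exists_union : ∀ {X : V} (A B : Subobject X), ∃ S, IsLUB {A, B} S
  bot_stable : ∀ {X Y : V} (f : Y ⟶ X) (S : Subobject X), IsBot S →
    IsBot ((Subobject.pullback f).obj S)
  union_stable : ∀ {X Y : V} (f : Y ⟶ X) (A B S : Subobject X), IsLUB {A, B} S →
    IsLUB {(Subobject.pullback f).obj A, (Subobject.pullback f).obj B}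
      ((Subobject.pullback f).obj S)

/-- The image of a subobject under a functor which preserves monomorphisms. -/
noncomputable def mapSubobject {V : Type u} [Category.{v} V] {M : Type w} [Category.{w'} M]
    (F : V ⥤ M) [F.PreservesMonomorphisms] {X : V} (S : Subobject X) : Subobject (F.obj X) :=
  Subobject.mk (F.map S.arrow)

/-- Coherent functors: they preserve finite limits, regular epimorphisms and finite unions. -/
class IsCoherentFunctor {V : Type u} [Category.{v} V] {M : Type w} [Category.{w'} M]
    (F : V ⥤ M) : Prop extends PreservesFiniteLimits F where
  map_regularEpi : ∀ {X Y : V} (f : X ⟶ Y), IsRegularEpi f → IsRegularEpi (F.map f)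
  map_bot : ∀ {X : V} (S : Subobject X), IsBot S → IsBot (mapSubobject F S)
  map_union : ∀ {X : V} (A B S : Subobject X), IsLUB {A, B} S →
    IsLUB {mapSubobject F A, mapSubobject F B} (mapSubobject F S)

/-- A commutative square of functors from `p : T₁ ⥤ T₀` to the codomain functor `Mono V ⥤ V`:
the functor `m₀ : T₀ ⥤ V`, and the functor `m₁ : T₁ ⥤ Mono V` given by the domains `dom Φ` and
the monomorphisms `dom Φ ⟶ m₀ (p Φ)`. -/
structure TopeSquare {T₀ : Type u₀} [Category.{v₀} T₀] {T₁ : Type u₁} [Category.{v₁} T₁]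
    (p : T₁ ⥤ T₀) (V : Type u) [Category.{v} V] where
  m₀ : T₀ ⥤ V
  dom : T₁ ⥤ V
  incl : dom ⟶ p ⋙ m₀
  incl_mono : ∀ Φ : T₁, Mono (incl.app Φ)

/-- The subobject of `m₀ I` which interprets a tope over `I`. -/
noncomputable def TopeSquare.sub {T₀ : Type u₀} [Category.{v₀} T₀] {T₁ : Type u₁}
    [Category.{v₁} T₁] {p : T₁ ⥤ T₀} {V : Type u} [Category.{v} V] (m : TopeSquare p V)
    {I : T₀} (φ : Tope p I) : Subobject (m.m₀.obj I) :=
  haveI := m.incl_mono φ.1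
  Subobject.mk (m.incl.app φ.1 ≫ eqToHom (congrArg m.m₀.obj φ.2))

/-- A model of a propositional coherent theory `p : T₁ ⥤ T₀` in `V`: a square as above such that
`m₀` preserves finite products, and `m₁` preserves cartesian morphisms (those of `Mono V` are the
pullback squares) and, fibrewise, finite meets and finite joins. -/
structure TheoryModel {T₀ : Type u₀} [Category.{v₀} T₀] {T₁ : Type u₁} [Category.{v₁} T₁]
    (p : T₁ ⥤ T₀) (V : Type u) [Category.{v} V] extends TopeSquare p V where
  preservesFiniteProducts : PreservesFiniteProducts m₀
  map_cartesian : ∀ {Φ Ψ : T₁} (g : Φ ⟶ Ψ), p.IsStronglyCartesian (p.map g) g →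
    IsPullback (dom.map g) (incl.app Φ) (incl.app Ψ) (m₀.map (p.map g))
  map_top : ∀ {I : T₀} (χ : Tope p I), IsTop χ → IsTop (toTopeSquare.sub χ)
  map_bot : ∀ {I : T₀} (χ : Tope p I), IsBot χ → IsBot (toTopeSquare.sub χ)
  map_meet : ∀ {I : T₀} (φ ψ χ : Tope p I), IsGLB {φ, ψ} χ →
    IsGLB {toTopeSquare.sub φ, toTopeSquare.sub ψ} (toTopeSquare.sub χ)
  map_join : ∀ {I : T₀} (φ ψ χ : Tope p I), IsLUB {φ, ψ} χ →
    IsLUB {toTopeSquare.sub φ, toTopeSquare.sub ψ} (toTopeSquare.sub χ)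

/-- Right properness: weak equivalences are stable under pullback along fibrations. -/
def IsRightProper (M : Type u) [Category.{v} M] [ModelCategory M] : Prop :=
  ∀ {X' X Y' Y : M} {g' : X' ⟶ X} {f' : X' ⟶ Y'} {f : X ⟶ Y} {g : Y' ⟶ Y},
    IsPullback g' f' f g → Fibration f → WeakEquivalence g → WeakEquivalence g'

/-- A finitary model category with `T`-shapes `(M, V, T, ω)`, for `T = (p : T₁ ⥤ T₀)`. -/
structure FinitaryModelCategoryWithShapes {T₀ : Type u₀} [Category.{v₀} T₀]
    [HasFiniteProducts T₀] {T₁ : Type u₁} [Category.{v₁} T₁] (p : T₁ ⥤ T₀)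
    (V : Type u) [Category.{v} V] (M : Type w) [Category.{w'} M] [ModelCategory M] where
  topos : ElementaryTopos M
  rightProper : IsRightProper M
  cofibration_iff_mono : ∀ {X Y : M} (i : X ⟶ Y), Cofibration i ↔ Mono i
  theory : PropositionalCoherentTheory p
  coherentCategory : CoherentCategory V
  model : TheoryModel p V
  ω : V ⥤ M
  ω_coherent : IsCoherentFunctor ω
  ω_prod_acyclic : ∀ (U : V) {X Y : M} (i : X ⟶ Y), Cofibration i → WeakEquivalence i →
    WeakEquivalence (prod.map (𝟙 (ω.obj U)) i)

end ModelCategories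

/-! ## The induced comprehension category with shapes -/

section Induced

universe v₁ u₁ w' w

variable {T₁ : Type u₁} [Category.{v₁} T₁] {M : Type w} [Category.{w'} M]

/-- A context over a realization functor `R : T₁ ⥤ M`: a tope context `Φ` and a morphism
`Γ ⟶ R Φ` in the class `P` of context maps. -/
structure ShapeContext (R : T₁ ⥤ M) (P : MorphismProperty M) where
  shape : T₁
  tot : M
  str : tot ⟶ R.obj shape
  mem : P str

namespace ShapeContext

variable {R : T₁ ⥤ M} {P : MorphismProperty M}

/-- Substitutions: commutative squares over morphisms of tope contexts. -/
@[ext]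
structure Hom (Γ Δ : ShapeContext R P) where
  shape : Γ.shape ⟶ Δ.shape
  tot : Γ.tot ⟶ Δ.tot
  w : tot ≫ Δ.str = Γ.str ≫ R.map shape := by cat_disch

@[simps]
instance : Category (ShapeContext R P) where
  Hom := Hom
  id Γ := { shape := 𝟙 _, tot := 𝟙 _ }
  comp {Γ Δ Θ} f g :=
    { shape := f.shape ≫ g.shape
      tot := f.tot ≫ g.tot
      w := by
        have hf := f.w
        have hg := g.w
        rw [Category.assoc, hg, ← Category.assoc, hf, Category.assoc, R.map_comp] }

@[ext]
lemma hom_ext {Γ Δ : ShapeContext R P} {f g : Γ ⟶ Δ} (h₁ : f.shape = g.shape)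
    (h₂ : f.tot = g.tot) : f = g :=
  Hom.ext h₁ h₂

variable (R P) in
/-- The fibration of contexts over tope contexts. -/
@[simps]
def toShape : ShapeContext R P ⥤ T₁ where
  obj Γ := Γ.shape
  map f := f.shape

lemma eq_shape_of_isHomLift {Γ Δ : ShapeContext R P} (f : Γ.shape ⟶ Δ.shape) (k : Γ ⟶ Δ)
    (h : (toShape R P).IsHomLift f k) : f = k.shape :=
  @IsHomLift.eq_of_isHomLift _ _ _ _ (toShape R P) Γ Δ f k h

lemma isHomLift_shape {Γ Δ : ShapeContext R P} (k : Γ ⟶ Δ) :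
    (toShape R P).IsHomLift k.shape k :=
  inferInstanceAs ((toShape R P).IsHomLift ((toShape R P).map k) k)

lemma existsUnique_lift {Γ Δ Θ : ShapeContext R P} (f : Γ ⟶ Δ)
    (h : IsPullback f.tot Γ.str Δ.str (R.map f.shape)) (g : Θ.shape ⟶ Γ.shape) (k : Θ ⟶ Δ)
    (e : g ≫ f.shape = k.shape) :
    ∃! x : Θ ⟶ Γ, (toShape R P).IsHomLift g x ∧ x ≫ f = k := by
  have w : k.tot ≫ Δ.str = (Θ.str ≫ R.map g) ≫ R.map f.shape := by
    rw [k.w, ← e, R.map_comp, Category.assoc]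
  let y : Θ ⟶ Γ := { shape := g, tot := h.lift k.tot (Θ.str ≫ R.map g) w }
  refine ⟨y, ⟨isHomLift_shape y, hom_ext e (h.lift_fst _ _ _)⟩, ?_⟩
  rintro x ⟨hx, rfl⟩
  have e' := eq_shape_of_isHomLift g x hx
  refine hom_ext e'.symm (h.hom_ext ((h.lift_fst _ _ _).symm) ?_)
  refine Eq.trans ?_ (h.lift_snd _ _ _).symm
  rw [e', x.w]

/-- Morphisms of contexts whose underlying square is a pullback are cartesian. -/
lemma isStronglyCartesian {Γ Δ : ShapeContext R P} (f : Γ ⟶ Δ)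
    (h : IsPullback f.tot Γ.str Δ.str (R.map f.shape)) :
    (toShape R P).IsStronglyCartesian f.shape f where
  toIsHomLift := isHomLift_shape f
  universal_property' g k hk := existsUnique_lift f h g k (eq_shape_of_isHomLift _ k hk)

lemma toShape_isFibered [HasPullbacks M] [P.IsStableUnderBaseChange] :
    (toShape R P).IsFibered := by
  refine Functor.IsFibered.of_exists_isStronglyCartesian fun Δ Φ f ↦ ?_
  let Γ : ShapeContext R P :=
    { shape := Φ
      tot := pullback Δ.str (R.map f)
      str := pullback.snd _ _
      mem := P.pullback_snd _ _ Δ.mem }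
  let k : Γ ⟶ Δ := { shape := f, tot := pullback.fst _ _, w := pullback.condition }
  exact ⟨Γ, k, isStronglyCartesian k (IsPullback.of_hasPullback _ _)⟩

lemma exists_empty [P.ContainsIdentities] (Φ : T₁) : ∃ X : ShapeContext R P,
    (toShape R P).obj X = Φ ∧ ∀ (Y : ShapeContext R P) (f : (toShape R P).obj Y ⟶ Φ),
      ∃! g : Y ⟶ X, (toShape R P).IsHomLift f g := by
  refine ⟨{ shape := Φ, tot := R.obj Φ, str := 𝟙 _, mem := P.id_mem _ }, rfl, fun Y f ↦ ?_⟩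
  let X : ShapeContext R P := { shape := Φ, tot := R.obj Φ, str := 𝟙 _, mem := P.id_mem _ }
  let k : Y ⟶ X := { shape := f, tot := Y.str ≫ R.map f, w := Category.comp_id _ }
  refine ⟨k, isHomLift_shape k, fun x hx ↦ ?_⟩
  have e : f = x.shape := eq_shape_of_isHomLift (Δ := X) f x hx
  refine hom_ext e.symm ?_
  have hw : x.tot ≫ 𝟙 _ = Y.str ≫ R.map x.shape := x.w
  exact (Category.comp_id _).symm.trans (hw.trans (congrArg (fun t ↦ Y.str ≫ R.map t) e.symm))

end ShapeContext

variable [ModelCategory M]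

/-- A type in context `Γ`: a fibration `A ⟶ Γ`. -/
structure ContextType (R : T₁ ⥤ M) (P : MorphismProperty M) where
  base : ShapeContext R P
  tot : M
  disp : tot ⟶ base.tot
  fib : Fibration disp

namespace ContextType

variable {R : T₁ ⥤ M} {P : MorphismProperty M}

/-- Morphisms of types: commutative squares over substitutions. -/
@[ext]
structure Hom (A B : ContextType R P) where
  base : A.base ⟶ B.base
  tot : A.tot ⟶ B.tot
  w : tot ≫ B.disp = A.disp ≫ base.tot := by cat_disch

@[simps]
instance : Category (ContextType R P) where
  Hom := Hom
  id A := { base := 𝟙 _, tot := 𝟙 _ }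
  comp {A B D} f g :=
    { base := f.base ≫ g.base
      tot := f.tot ≫ g.tot
      w := by
        have hf := f.w
        have hg := g.w
        rw [Category.assoc, hg, ← Category.assoc, hf, Category.assoc]
        rfl }

@[ext]
lemma hom_ext {A B : ContextType R P} {f g : A ⟶ B} (h₁ : f.base = g.base)
    (h₂ : f.tot = g.tot) : f = g :=
  Hom.ext h₁ h₂

variable (R P) in
/-- The fibration of types over contexts. -/
@[simps]
def toContext : ContextType R P ⥤ ShapeContext R P where
  obj A := A.base
  map f := f.base

lemma eq_base_of_isHomLift {A B : ContextType R P} (f : A.base ⟶ B.base) (k : A ⟶ B)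
    (h : (toContext R P).IsHomLift f k) : f = k.base :=
  @IsHomLift.eq_of_isHomLift _ _ _ _ (toContext R P) A B f k h

lemma isHomLift_base {A B : ContextType R P} (k : A ⟶ B) :
    (toContext R P).IsHomLift k.base k :=
  inferInstanceAs ((toContext R P).IsHomLift ((toContext R P).map k) k)

lemma existsUnique_lift {A B D : ContextType R P} (f : A ⟶ B)
    (h : IsPullback f.tot A.disp B.disp f.base.tot) (g : D.base ⟶ A.base) (k : D ⟶ B)
    (e : g ≫ f.base = k.base) :
    ∃! x : D ⟶ A, (toContext R P).IsHomLift g x ∧ x ≫ f = k := by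
  have w : k.tot ≫ B.disp = (D.disp ≫ g.tot) ≫ f.base.tot := by
    rw [k.w, ← e, Category.assoc]; rfl
  let y : D ⟶ A := { base := g, tot := h.lift k.tot (D.disp ≫ g.tot) w }
  refine ⟨y, ⟨isHomLift_base y, hom_ext e (h.lift_fst _ _ _)⟩, ?_⟩
  rintro x ⟨hx, rfl⟩
  have e' := eq_base_of_isHomLift g x hx
  refine hom_ext e'.symm (h.hom_ext ((h.lift_fst _ _ _).symm) ?_)
  refine Eq.trans ?_ (h.lift_snd _ _ _).symm
  rw [e', x.w]

/-- Morphisms of types whose underlying square is a pullback are cartesian. -/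
lemma isStronglyCartesian {A B : ContextType R P} (f : A ⟶ B)
    (h : IsPullback f.tot A.disp B.disp f.base.tot) :
    (toContext R P).IsStronglyCartesian f.base f where
  toIsHomLift := isHomLift_base f
  universal_property' g k hk := existsUnique_lift f h g k (eq_base_of_isHomLift _ k hk)

/-- The reindexing of a type along a substitution. -/
noncomputable def reindex (B : ContextType R P) {Γ : ShapeContext R P} (f : Γ ⟶ B.base) :
    ContextType R P where
  base := Γ
  tot := pullback B.disp f.tot
  disp := pullback.snd _ _
  fib := by
    have := B.fib
    infer_instance

/-- The canonical morphism from a reindexed type. -/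
noncomputable def reindexHom (B : ContextType R P) {Γ : ShapeContext R P} (f : Γ ⟶ B.base) :
    B.reindex f ⟶ B where
  base := f
  tot := pullback.fst _ _
  w := pullback.condition

lemma reindexHom_isPullback (B : ContextType R P) {Γ : ShapeContext R P} (f : Γ ⟶ B.base) :
    IsPullback (B.reindexHom f).tot (B.reindex f).disp B.disp f.tot :=
  IsPullback.of_hasPullback _ _

lemma toContext_isFibered : (toContext R P).IsFibered :=
  Functor.IsFibered.of_exists_isStronglyCartesian fun B _ f ↦
    ⟨B.reindex f, B.reindexHom f, isStronglyCartesian _ (B.reindexHom_isPullback f)⟩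

/-- Cartesian morphisms of types have underlying pullback squares. -/
lemma isPullback_of_isStronglyCartesian {A B : ContextType R P} (f : A ⟶ B)
    (hf : (toContext R P).IsStronglyCartesian f.base f) :
    IsPullback f.tot A.disp B.disp f.base.tot := by
  have h := B.reindexHom_isPullback f.base
  have hc : (toContext R P).IsStronglyCartesian f.base (B.reindexHom f.base) :=
    isStronglyCartesian (B.reindexHom f.base) h
  let e := Functor.IsCartesian.domainUniqueUpToIso (toContext R P) f.base
    (B.reindexHom f.base) f
  have he : (toContext R P).IsHomLift (𝟙 A.base) e.hom := inferInstance
  have hb : 𝟙 A.base = e.hom.base := eq_base_of_isHomLift (B := B.reindex f.base) _ e.hom he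
  have hfac : e.hom ≫ B.reindexHom f.base = f :=
    Functor.IsCartesian.fac (toContext R P) f.base (B.reindexHom f.base) f
  let e' : A.tot ≅ (B.reindex f.base).tot :=
    { hom := e.hom.tot
      inv := e.inv.tot
      hom_inv_id := congrArg Hom.tot e.hom_inv_id
      inv_hom_id := congrArg Hom.tot e.inv_hom_id }
  have h₁ : e'.hom ≫ (B.reindexHom f.base).tot = f.tot := congrArg Hom.tot hfac
  have h₂ : e'.hom ≫ (B.reindex f.base).disp = A.disp := by
    have hw : e.hom.tot ≫ (B.reindex f.base).disp = A.disp ≫ e.hom.base.tot := e.hom.w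
    rw [← hb] at hw
    exact hw.trans (Category.comp_id _)
  refine IsPullback.of_iso h e'.symm (Iso.refl _) (Iso.refl _) (Iso.refl _) ?_ ?_ ?_ ?_
  · rw [← h₁]
    exact (Category.comp_id _).trans (e'.inv_hom_id_assoc _).symm
  · rw [← h₂]
    exact (Category.comp_id _).trans (e'.inv_hom_id_assoc _).symm
  · exact (Category.comp_id _).trans (Category.id_comp _).symm
  · exact (Category.comp_id _).trans (Category.id_comp _).symm

variable [P.IsMultiplicative] (hP : fibrations M ≤ P)

variable (R) in
/-- Context extension. -/
@[simps]
def extension : ContextType R P ⥤ ShapeContext R P where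
  obj A :=
    { shape := A.base.shape
      tot := A.tot
      str := A.disp ≫ A.base.str
      mem := P.comp_mem _ _ (hP _ ((fibration_iff _).1 A.fib)) A.base.mem }
  map f :=
    { shape := f.base.shape
      tot := f.tot
      w := by rw [← Category.assoc, f.w, Category.assoc, f.base.w, Category.assoc] }

variable (R) in
/-- Display maps. -/
@[simps]
def display : extension R hP ⟶ toContext R P where
  app A := { shape := 𝟙 _, tot := A.disp, w := (Category.comp_id _).symm.trans (congrArg (_ ≫ ·) (R.map_id _).symm) }
  naturality A B f := by
    ext
    · exact (Category.comp_id _).trans (Category.id_comp _).symm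
    · exact f.w

lemma display_isPullback {A B : ContextType R P} (f : A ⟶ B)
    (h : IsPullback f.tot A.disp B.disp f.base.tot) :
    IsPullback ((extension R hP).map f) ((display R hP).app A) ((display R hP).app B)
      ((toContext R P).map f) := by
  refine ⟨⟨((display R hP).naturality f)⟩, ⟨PullbackCone.IsLimit.mk _ (fun s ↦
    { shape := s.snd.shape
      tot := h.lift s.fst.tot s.snd.tot (congrArg ShapeContext.Hom.tot s.condition)
      w := ?_ }) ?_ ?_ ?_⟩⟩
  · have := s.snd.w
    exact (Category.assoc _ _ _).symm.trans ((congrArg (· ≫ _) (h.lift_snd _ _ _)).trans this)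
  · intro s
    ext
    · have := congrArg ShapeContext.Hom.shape s.condition
      exact this.symm.trans (Category.comp_id _)
    · exact h.lift_fst _ _ _
  · intro s
    ext
    · exact Category.comp_id _
    · exact h.lift_snd _ _ _
  · intro s m h₁ h₂
    ext
    · have := congrArg ShapeContext.Hom.shape h₂
      exact (Category.comp_id _).symm.trans this
    · apply h.hom_ext
      · exact (congrArg ShapeContext.Hom.tot h₁).trans (h.lift_fst _ _ _).symm
      · exact (congrArg ShapeContext.Hom.tot h₂).trans (h.lift_snd _ _ _).symm

end ContextType

end Induced

namespace FinitaryModelCategoryWithShapes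

universe v₀ u₀ v₁ u₁ v u w' w

variable {T₀ : Type u₀} [Category.{v₀} T₀] [HasFiniteProducts T₀] {T₁ : Type u₁}
  [Category.{v₁} T₁] {p : T₁ ⥤ T₀} {V : Type u} [Category.{v} V] {M : Type w} [Category.{w'} M]
  [ModelCategory M]

/-- The realization of tope contexts in `M`. -/
abbrev realization (S : FinitaryModelCategoryWithShapes p V M) : T₁ ⥤ M :=
  S.model.dom ⋙ S.ω

/-- The induced comprehension category with shapes: its cube and tope layers are those of the
theory, a context over a tope context `Φ` is a morphism `Γ ⟶ R Φ` to the realization of `Φ`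
in the class `P` of context maps (for example: all morphisms, or all fibrations), and
a type in context `Γ` is a fibration over `Γ`, with itself as context extension. -/
def inducedCompCat (S : FinitaryModelCategoryWithShapes p V M) (P : MorphismProperty M)
    [P.IsMultiplicative] [P.IsStableUnderBaseChange] (hP : fibrations M ≤ P) :
    CompCatWithShapes T₀ T₁ (ShapeContext S.realization P) (ContextType S.realization P) where
  tope := p
  ctx := ShapeContext.toShape S.realization P
  typ := ContextType.toContext S.realization P
  ext := ContextType.extension S.realization hP
  π := ContextType.display S.realization hP
  cubes_products := inferInstance
  tope_fibered := S.theory.fibered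
  tope_faithful := S.theory.faithful
  ctx_fibered := ShapeContext.toShape_isFibered
  exists_empty := ShapeContext.exists_empty
  typ_fibered := ContextType.toContext_isFibered
  π_vertical A := ShapeContext.isHomLift_shape ((ContextType.display S.realization hP).app A)
  π_cartesian f hf := ContextType.display_isPullback hP f
    (ContextType.isPullback_of_isStronglyCartesian f hf)

end FinitaryModelCategoryWithShapes

end SimplicialTT

/-!
Unions of subobjects in an elementary topos are effective: if two monomorphisms jointly cover `X`,
then a pair of morphisms out of their domains which agrees on all pairs of generalized elements with
the same image in `X` comes from a unique morphism out of `X` (`JointlyCovering.existsUnique_glue`,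
proved by building the graph of the glued morphism with the subobject classifier). Coverings are
stable under base change. Since the model of the topes and `ω` preserve meets, joins, `⊥` and
products, the realization of a context whose topes entail `φ ∨ ψ` is jointly covered by its
restrictions to `φ` and `ψ`, and terms glue; initial objects are strict, so that a context over `⊥`
has an initial underlying object and its types have exactly one term (`hasTopeDisjunctionElim`).

The extension of a context `Γ` by a shape `ψ` has the underlying object `R ψ ⨯ Γ`. So the data of an
extension problem is a monomorphism `m : R φ ⟶ R ψ`, a fibration `q : A ⟶ R ψ ⨯ Γ` and a section `a`
of `q` over `R φ ⨯ Γ`, and an extension type is an object `e : E ⟶ Γ` over `Γ` which represents the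
sections of `q` extending `a` (`IsSectionObject`). It exists because `M` is cartesian closed
(`exists_isSectionObject`). Lifting a monomorphism `i` against `e` amounts to lifting the pushout
product of `m` and `i` against `q`. By effectivity of unions this pushout product is again
a monomorphism, and if `i` is a trivial cofibration, it is one as well, since `R ψ ⨯ -` and
`R φ ⨯ -` preserve trivial cofibrations. Hence `e` is a fibration (`IsSectionObject.fibration`), and
it is trivial if `q` is (`IsSectionObject.trivialFibration`). The universal property gives the
cartesian comparison morphisms and their functoriality (`pseudoStableExtensionTypes`).

A type is contractible if and only if its fibration is trivial. Type elimination says that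
reflexivity lifts against fibrations, so it is a trivial cofibration, and two-out-of-three and
retracts show that contractible types are weak equivalences (`weakEquivalence_projTot`).
Conversely, over a trivial fibration the identity of `A ×_Γ A` is an identity type and the fibration
has a section (`isContractible_of_weakEquivalence`). Relative function extensionality is then
the statement that the object of sections of a trivial fibration is a trivial fibration.
-/

namespace SimplicialTT

/-! ### Universal quantification, unions and gluing in an elementary topos -/

section Topos

universe v u

variable {M : Type u} [Category.{v} M]

attribute [local simp] prod.lift_fst prod.lift_snd prod.lift_fst_assoc prod.lift_snd_assoc

/-- A pair of morphisms covers `X` if no proper subobject of `X` contains the images of both. -/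
def JointlyCovering {A B X : M} (a : A ⟶ X) (b : B ⟶ X) : Prop :=
  ∀ ⦃T : M⦄ (t : T ⟶ X) [Mono t], (∃ l, l ≫ t = a) → (∃ l, l ≫ t = b) → IsIso t

lemma JointlyCovering.hom_ext [HasEqualizers M] {A B X T : M} {a : A ⟶ X} {b : B ⟶ X}
    (h : JointlyCovering a b) {f g : X ⟶ T} (ha : a ≫ f = a ≫ g) (hb : b ≫ f = b ≫ g) :
    f = g := by
  have := h (equalizer.ι f g) ⟨equalizer.lift a ha, equalizer.lift_ι _ _⟩
    ⟨equalizer.lift b hb, equalizer.lift_ι _ _⟩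
  rw [← cancel_epi (equalizer.ι f g), equalizer.condition]

section Classifier

variable [HasSubobjectClassifier M]

lemma exists_factor_iff_comp_χ {U X Y : M} (m : U ⟶ X) [Mono m] (y : Y ⟶ X) :
    (∃ l, l ≫ m = y) ↔ y ≫ HasSubobjectClassifier.χ m =
      Subobject.Classifier.χ₀ _ Y ≫ HasSubobjectClassifier.truth M := by
  have hm := HasSubobjectClassifier.isPullback_χ m
  constructor
  · rintro ⟨l, rfl⟩
    rw [Category.assoc, hm.w, ← Category.assoc]
    exact congrArg (· ≫ _) (Subsingleton.elim _ _)
  · intro h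
    exact ⟨hm.lift y _ h, hm.lift_fst _ _ _⟩

/-- Characteristic maps agree after `y` if and only if the two subobjects contain the same
generalized elements of the form `v ≫ y`. -/
lemma comp_χ_eq_iff [HasPullbacks M] {U U' X Y : M} (m : U ⟶ X) (m' : U' ⟶ X) [Mono m] [Mono m']
    (y : Y ⟶ X) :
    y ≫ HasSubobjectClassifier.χ m = y ≫ HasSubobjectClassifier.χ m' ↔
      ∀ ⦃W : M⦄ (v : W ⟶ Y), (∃ l, l ≫ m = v ≫ y) ↔ ∃ l, l ≫ m' = v ≫ y := by
  constructor
  · intro h W v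
    rw [exists_factor_iff_comp_χ, exists_factor_iff_comp_χ, Category.assoc, Category.assoc, h]
  · intro h
    have h₁ : IsPullback (pullback.snd m y) (Subobject.Classifier.χ₀ _ (pullback m y))
        (y ≫ HasSubobjectClassifier.χ m) (HasSubobjectClassifier.truth M) := by
      have := (IsPullback.of_hasPullback m y).flip.paste_vert
        (HasSubobjectClassifier.isPullback_χ m)
      convert this using 1
      exact Subsingleton.elim _ _
    rw [HasSubobjectClassifier.unique _ _ h₁]
    refine (HasSubobjectClassifier.unique _ _ ?_).symm
    obtain ⟨l, hl⟩ := (h (pullback.snd m y)).1 ⟨pullback.fst m y, pullback.condition⟩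
    have w : pullback.snd m y ≫ y ≫ HasSubobjectClassifier.χ m' =
        Subobject.Classifier.χ₀ _ _ ≫ HasSubobjectClassifier.truth M := by
      rw [← Category.assoc]
      exact (exists_factor_iff_comp_χ m' _).1 ⟨l, hl⟩
    have hs (s : PullbackCone (y ≫ HasSubobjectClassifier.χ m') (HasSubobjectClassifier.truth M)) :
        ∃ k, k ≫ m = s.fst ≫ y := by
      refine (h s.fst).2 ((exists_factor_iff_comp_χ m' _).2 ?_)
      rw [Category.assoc, s.condition]
      exact congrArg (· ≫ _) (Subsingleton.elim _ _)
    refine ⟨⟨w⟩, ⟨PullbackCone.IsLimit.mk w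
      (fun s ↦ pullback.lift (hs s).choose s.fst (hs s).choose_spec) ?_ ?_ ?_⟩⟩
    · intro s
      exact pullback.lift_snd _ _ _
    · intro s
      exact Subsingleton.elim _ _
    · intro s k hk _
      rw [← cancel_mono (pullback.snd m y), hk, pullback.lift_snd]

end Classifier

variable [HasFiniteLimits M] [ElementaryTopos M]

/-- Universal quantification of the subobject `t` along `f`, characterized by its generalized
elements.  With `χ` and `χ'` the characteristic maps of the graph of `f` and of its restriction
to `t`, it is the subobject of those `x` at which `χ (z, x) = χ' (z, x)` for all `z`. -/
lemma exists_forall_along {Z X T : M} (f : Z ⟶ X) (t : T ⟶ Z) [Mono t] :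
    ∃ (F : M) (n : F ⟶ X), Mono n ∧ ∀ ⦃Y : M⦄ (y : Y ⟶ X), (∃ l, l ≫ n = y) ↔
      ∀ ⦃W : M⦄ (w : W ⟶ Z) (v : W ⟶ Y), w ≫ f = v ≫ y → ∃ l : W ⟶ T, l ≫ t = w := by
  have := ElementaryTopos.hasClassifier (M := M)
  have := ElementaryTopos.cartesianClosed Z
  let adj := Adjunction.ofIsLeftAdjoint (prod.functor.obj Z)
  let gr : Z ⟶ Z ⨯ X := prod.lift (𝟙 Z) f
  have : Mono gr := mono_of_mono_fac (prod.lift_fst (𝟙 Z) f)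
  let c : (Z ⨯ X ⟶ HasSubobjectClassifier.Ω M) → (X ⟶ _) :=
    adj.homEquiv X (HasSubobjectClassifier.Ω M)
  let χ₁ := HasSubobjectClassifier.χ gr
  let χ₂ := HasSubobjectClassifier.χ (t ≫ gr)
  refine ⟨equalizer (c χ₁) (c χ₂), equalizer.ι _ _, inferInstance, fun Y y ↦ ?_⟩
  have key : (∃ l, l ≫ equalizer.ι (c χ₁) (c χ₂) = y) ↔
      prod.map (𝟙 Z) y ≫ χ₁ = prod.map (𝟙 Z) y ≫ χ₂ := by
    have hc (χ : Z ⨯ X ⟶ HasSubobjectClassifier.Ω M) :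
        y ≫ c χ = adj.homEquiv Y _ (prod.map (𝟙 Z) y ≫ χ) :=
      (adj.homEquiv_naturality_left y χ).symm
    constructor
    · rintro ⟨l, hl⟩
      apply (adj.homEquiv Y _).injective
      refine (hc χ₁).symm.trans (Eq.trans ?_ (hc χ₂))
      rw [← hl, Category.assoc, Category.assoc, equalizer.condition]
    · intro h
      refine ⟨equalizer.lift y ?_, equalizer.lift_ι _ _⟩
      exact (hc χ₁).trans ((congrArg (adj.homEquiv Y _) h).trans (hc χ₂).symm)
  rw [key, comp_χ_eq_iff]
  constructor
  · intro h W w v hwv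
    obtain ⟨l, hl⟩ := (h (prod.lift w v)).1 ⟨w, by
      ext <;> simp [gr, hwv]⟩
    refine ⟨l, ?_⟩
    simpa [gr] using congrArg (· ≫ prod.fst) hl
  · intro h W v
    constructor
    · rintro ⟨l, hl⟩
      have h₁ : l = v ≫ prod.fst := by simpa [gr] using congrArg (· ≫ prod.fst) hl
      have h₂ : l ≫ f = v ≫ prod.snd ≫ y := by simpa [gr] using congrArg (· ≫ prod.snd) hl
      obtain ⟨k, hk⟩ := h l (v ≫ prod.snd) (by simpa using h₂)
      exact ⟨k, by rw [← hl, ← hk, Category.assoc]⟩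
    · rintro ⟨l, hl⟩
      exact ⟨l ≫ t, by rw [← hl, Category.assoc]⟩

/-- Coverings by two morphisms are stable under pullback. -/
lemma JointlyCovering.of_isPullback {A B X A' B' Z : M} {a : A ⟶ X} {b : B ⟶ X}
    (h : JointlyCovering a b) {f : Z ⟶ X} {a' : A' ⟶ Z} {fa : A' ⟶ A} {b' : B' ⟶ Z} {fb : B' ⟶ B}
    (ha : IsPullback fa a' a f) (hb : IsPullback fb b' b f) : JointlyCovering a' b' := by
  intro T t _ hta htb
  obtain ⟨F, n, hn, hF⟩ := exists_forall_along f t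
  have : IsIso n := by
    refine h n ((hF a).2 fun W w v hwv ↦ ?_) ((hF b).2 fun W w v hwv ↦ ?_)
    · obtain ⟨l, hl⟩ := hta
      exact ⟨ha.lift v w hwv.symm ≫ l, by rw [Category.assoc, hl, ha.lift_snd]⟩
    · obtain ⟨l, hl⟩ := htb
      exact ⟨hb.lift v w hwv.symm ≫ l, by rw [Category.assoc, hl, hb.lift_snd]⟩
  obtain ⟨l, hl⟩ := (hF (𝟙 X)).1 ⟨inv n, IsIso.inv_hom_id n⟩ (𝟙 Z) f (by simp)
  exact ⟨l, by rw [← cancel_mono t, Category.assoc, hl, Category.comp_id, Category.id_comp], hl⟩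

/-- The subobject of those `(x, s) : X ⨯ T` such that `s = u x` whenever `x` lies in `A`. -/
lemma exists_partial_graph {A X T : M} (a : A ⟶ X) [Mono a] (u : A ⟶ T) :
    ∃ (F : M) (n : F ⟶ X ⨯ T), Mono n ∧ ∀ ⦃Y : M⦄ (x : Y ⟶ X) (s : Y ⟶ T),
      (∃ l, l ≫ n = prod.lift x s) ↔
        ∀ ⦃W : M⦄ (w : W ⟶ A) (v : W ⟶ Y), w ≫ a = v ≫ x → w ≫ u = v ≫ s := by
  have : Mono (prod.lift (𝟙 A) u) := mono_of_mono_fac (prod.lift_fst (𝟙 A) u)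
  obtain ⟨F, n, hn, hF⟩ := exists_forall_along (prod.map a (𝟙 T)) (prod.lift (𝟙 A) u)
  refine ⟨F, n, hn, fun Y x s ↦ (hF _).trans ⟨fun h W w v hwv ↦ ?_, fun h W w v hwv ↦ ?_⟩⟩
  · obtain ⟨l, hl⟩ := h (prod.lift w (v ≫ s)) v (by simp [hwv])
    have h₁ : l = w := by simpa using congrArg (· ≫ prod.fst) hl
    have h₂ : l ≫ u = v ≫ s := by simpa using congrArg (· ≫ prod.snd) hl
    rw [← h₁, h₂]
  · have h₁ : (w ≫ prod.fst) ≫ a = v ≫ x := by simpa using congrArg (· ≫ prod.fst) hwv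
    have h₂ : w ≫ prod.snd = v ≫ s := by simpa using congrArg (· ≫ prod.snd) hwv
    exact ⟨w ≫ prod.fst, by ext <;> simp [h _ _ h₁, h₂]⟩

/-- Unions are effective: two subobjects which cover `X` exhibit it as their pushout over their
intersection.  The glued morphism is the relation `x ∈ A → s = u x` and `x ∈ B → s = v x`, which is
single valued, and total because it is defined on both `A` and `B`. -/
lemma JointlyCovering.existsUnique_glue {A B X T : M} {a : A ⟶ X} {b : B ⟶ X} [Mono a] [Mono b]
    (h : JointlyCovering a b) (u : A ⟶ T) (v : B ⟶ T)
    (huv : ∀ ⦃W : M⦄ (w : W ⟶ A) (w' : W ⟶ B), w ≫ a = w' ≫ b → w ≫ u = w' ≫ v) :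
    ∃! g : X ⟶ T, a ≫ g = u ∧ b ≫ g = v := by
  obtain ⟨F, n, hn, hF⟩ := exists_partial_graph a u
  obtain ⟨G, k, hk, hG⟩ := exists_partial_graph b v
  let H := pullback n k
  let i : H ⟶ X ⨯ T := pullback.fst n k ≫ n
  have hi : i = pullback.snd n k ≫ k := pullback.condition
  have hiF := (hF (i ≫ prod.fst) (i ≫ prod.snd)).1 ⟨pullback.fst n k, by
    ext <;> simp [i]⟩
  have hiG := (hG (i ≫ prod.fst) (i ≫ prod.snd)).1 ⟨pullback.snd n k, by
    rw [← hi]; ext <;> simp⟩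
  have lift_H {Y : M} (x : Y ⟶ X) (s : Y ⟶ T)
      (h₁ : ∀ ⦃W : M⦄ (w : W ⟶ A) (v : W ⟶ Y), w ≫ a = v ≫ x → w ≫ u = v ≫ s)
      (h₂ : ∀ ⦃W : M⦄ (w : W ⟶ B) (w' : W ⟶ Y), w ≫ b = w' ≫ x → w ≫ v = w' ≫ s) :
      ∃ l : Y ⟶ H, l ≫ i = prod.lift x s := by
    obtain ⟨l₁, hl₁⟩ := (hF x s).2 h₁
    obtain ⟨l₂, hl₂⟩ := (hG x s).2 h₂
    exact ⟨pullback.lift l₁ l₂ (hl₁.trans hl₂.symm), by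
      rw [← Category.assoc, pullback.lift_fst, hl₁]⟩
  -- the relation `H` is single valued: its values agree on the restrictions of `Y` to `A` and `B`,
  -- and these cover `Y` because coverings are stable under base change
  have mono_q : Mono (i ≫ prod.fst) := by
    refine ⟨fun {Y} g g' hgg' ↦ ?_⟩
    replace hgg' : g ≫ i ≫ prod.fst = g' ≫ i ≫ prod.fst := hgg'
    have hc := h.of_isPullback (IsPullback.of_hasPullback a (g ≫ i ≫ prod.fst))
      (IsPullback.of_hasPullback b (g ≫ i ≫ prod.fst))
    have hca := pullback.condition (f := a) (g := g ≫ i ≫ prod.fst)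
    have hcb := pullback.condition (f := b) (g := g ≫ i ≫ prod.fst)
    have e : g ≫ i ≫ prod.snd = g' ≫ i ≫ prod.snd := by
      apply hc.hom_ext
      · have h₁ := hiF _ (pullback.snd a (g ≫ i ≫ prod.fst) ≫ g) (by simpa using hca)
        have h₂ := hiF _ (pullback.snd a (g ≫ i ≫ prod.fst) ≫ g') (by
          simpa using hca.trans (congrArg (_ ≫ ·) hgg'))
        simpa using h₁.symm.trans h₂
      · have h₁ := hiG _ (pullback.snd b (g ≫ i ≫ prod.fst) ≫ g) (by simpa using hcb)
        have h₂ := hiG _ (pullback.snd b (g ≫ i ≫ prod.fst) ≫ g') (by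
          simpa using hcb.trans (congrArg (_ ≫ ·) hgg'))
        simpa using h₁.symm.trans h₂
    have e' : g ≫ i = g' ≫ i := by
      ext
      · simpa using hgg'
      · simpa using e
    rw [← cancel_mono (pullback.fst n k), ← cancel_mono n]
    simpa [i] using e'
  -- the graphs of `u` and `v` lie in `H`, so that the domain of `H` contains `A` and `B`
  obtain ⟨la, hla⟩ := lift_H a u (fun W w w' hw ↦ by rw [cancel_mono] at hw; rw [hw])
    (fun W w w' hw ↦ (huv w' w hw.symm).symm)
  obtain ⟨lb, hlb⟩ := lift_H b v huv (fun W w w' hw ↦ by rw [cancel_mono] at hw; rw [hw])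
  have : IsIso (i ≫ prod.fst) := h _ ⟨la, by rw [← Category.assoc, hla, prod.lift_fst]⟩
    ⟨lb, by rw [← Category.assoc, hlb, prod.lift_fst]⟩
  have ha : a ≫ inv (i ≫ prod.fst) = la := by
    rw [IsIso.comp_inv_eq, ← Category.assoc, hla, prod.lift_fst]
  have hb : b ≫ inv (i ≫ prod.fst) = lb := by
    rw [IsIso.comp_inv_eq, ← Category.assoc, hlb, prod.lift_fst]
  have hg₁ : a ≫ inv (i ≫ prod.fst) ≫ i ≫ prod.snd = u := by
    rw [← Category.assoc, ha, ← Category.assoc, hla, prod.lift_snd]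
  have hg₂ : b ≫ inv (i ≫ prod.fst) ≫ i ≫ prod.snd = v := by
    rw [← Category.assoc, hb, ← Category.assoc, hlb, prod.lift_snd]
  exact ⟨_, ⟨hg₁, hg₂⟩, fun g hg ↦ h.hom_ext (hg.1.trans hg₁.symm) (hg.2.trans hg₂.symm)⟩

/-- Any two morphisms to `X` cover a subobject of `X`, namely the equalizer of the cokernel pair of
the induced morphism from their coproduct. -/
lemma exists_jointlyCovering [HasFiniteColimits M] {A B X : M} (a : A ⟶ X) (b : B ⟶ X) :
    ∃ (S : M) (n : S ⟶ X) (a' : A ⟶ S) (b' : B ⟶ S), Mono n ∧ a' ≫ n = a ∧ b' ≫ n = b ∧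
      JointlyCovering a' b' := by
  have := ElementaryTopos.hasClassifier (M := M)
  obtain ⟨f, rfl, rfl⟩ : ∃ f : A ⨿ B ⟶ X, coprod.inl ≫ f = a ∧ coprod.inr ≫ f = b :=
    ⟨coprod.desc a b, coprod.inl_desc _ _, coprod.inr_desc _ _⟩
  let q₁ : X ⟶ pushout f f := pushout.inl f f
  let q₂ : X ⟶ pushout f f := pushout.inr f f
  let f' : A ⨿ B ⟶ equalizer q₁ q₂ := equalizer.lift f pushout.condition
  have hf' : f' ≫ equalizer.ι q₁ q₂ = f := equalizer.lift_ι _ _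
  refine ⟨equalizer q₁ q₂, equalizer.ι q₁ q₂, coprod.inl ≫ f', coprod.inr ≫ f',
    inferInstance, by rw [Category.assoc, hf'], by rw [Category.assoc, hf'], ?_⟩
  rintro T t _ ⟨l, hl⟩ ⟨k, hk⟩
  let n := t ≫ equalizer.ι q₁ q₂
  have hn : coprod.desc l k ≫ n = f := by
    apply coprod.hom_ext
    · rw [coprod.inl_desc_assoc, ← Category.assoc, hl, Category.assoc, hf']
    · rw [coprod.inr_desc_assoc, ← Category.assoc, hk, Category.assoc, hf']
  -- a subobject `n` through which `f` factors is the equalizer of morphisms `g₁`, `g₂`; they agree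
  -- after `f`, hence factor through the cokernel pair, hence agree on its equalizer
  obtain ⟨r⟩ : Nonempty (RegularMono n) := ⟨regularMonoOfMono n⟩
  obtain ⟨Z, g₁, g₂, w, lift⟩ : ∃ (Z : M) (g₁ g₂ : X ⟶ Z), n ≫ g₁ = n ≫ g₂ ∧
      ∀ {Y : M} (y : Y ⟶ X), y ≫ g₁ = y ≫ g₂ → ∃ s, s ≫ n = y :=
    ⟨r.Z, r.left, r.right, r.w, fun y hy ↦ ⟨_, (RegularMono.lift' r y hy).2⟩⟩
  have w' : f ≫ g₁ = f ≫ g₂ := by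
    rw [← hn, Category.assoc]
    exact (congrArg (_ ≫ ·) w).trans (Category.assoc _ _ _).symm
  have h₁ : q₁ ≫ pushout.desc g₁ g₂ w' = g₁ := pushout.inl_desc _ _ _
  have h₂ : q₂ ≫ pushout.desc g₁ g₂ w' = g₂ := pushout.inr_desc _ _ _
  obtain ⟨s, hs⟩ := lift (equalizer.ι q₁ q₂) (by
    refine (congrArg (_ ≫ ·) h₁.symm).trans (Eq.trans ?_ (congrArg (_ ≫ ·) h₂))
    exact equalizer.condition_assoc _ _ _)
  have hs' : s ≫ t = 𝟙 _ := by
    rw [← cancel_mono (equalizer.ι q₁ q₂), Category.assoc, hs, Category.id_comp]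
  exact ⟨s, by rw [← cancel_mono t, Category.assoc, hs', Category.comp_id, Category.id_comp], hs'⟩

/-- Initial objects of an elementary topos are strict. -/
lemma isIso_of_isInitial {A I : M} (hI : IsInitial I) (f : A ⟶ I) : IsIso f := by
  have := ElementaryTopos.cartesianClosed A
  have hAI : IsInitial (A ⨯ I) := hI.isInitialObj (prod.functor.obj A) I
  have h : prod.lift (𝟙 A) f ≫ prod.snd ≫ hI.to A = 𝟙 A := by
    have : (prod.snd : A ⨯ I ⟶ I) ≫ hI.to A = prod.fst := hAI.hom_ext _ _
    rw [this, prod.lift_fst]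
  exact ⟨hI.to A, by simpa using h, hI.hom_ext _ _⟩

lemma mono_of_isInitial {I X : M} (hI : IsInitial I) (f : I ⟶ X) : Mono f :=
  ⟨fun g h _ ↦ by
    have := isIso_of_isInitial hI g
    have := isIso_of_isInitial hI h
    exact eq_of_inv_eq_inv (hI.hom_ext _ _)⟩

end Topos

/-! ### Pushout products and objects of sections with prescribed restriction -/

section Sections

universe v u

variable {M : Type u} [Category.{v} M]

attribute [local simp] prod.lift_fst prod.lift_snd prod.lift_fst_assoc prod.lift_snd_assoc

/-- The pushout product of two monomorphisms of an elementary topos is a monomorphism. -/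
lemma exists_pushoutProduct [HasFiniteLimits M] [HasFiniteColimits M] [ElementaryTopos M]
    {U W X Y : M} (m : W ⟶ U) (i : X ⟶ Y) [Mono m] [Mono i] :
    ∃ (S : M) (n : S ⟶ U ⨯ Y) (c : U ⨯ X ⟶ S) (d : W ⨯ Y ⟶ S), Mono n ∧
      c ≫ n = prod.map (𝟙 U) i ∧ d ≫ n = prod.map m (𝟙 Y) ∧
      IsPushout (prod.map m (𝟙 X)) (prod.map (𝟙 W) i) c d := by
  obtain ⟨S, n, c, d, hn, hc, hd, h⟩ :=
    exists_jointlyCovering (prod.map (𝟙 U) i) (prod.map m (𝟙 Y))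
  refine ⟨S, n, c, d, hn, hc, hd, ?_⟩
  have w : prod.map m (𝟙 X) ≫ c = prod.map (𝟙 W) i ≫ d := by
    rw [← cancel_mono n, Category.assoc, Category.assoc, hc, hd]
    simp
  have : Mono c := mono_of_mono_fac hc
  have : Mono d := mono_of_mono_fac hd
  have key (s : PushoutCocone (prod.map m (𝟙 X)) (prod.map (𝟙 W) i)) :
      ∃! g : S ⟶ s.pt, c ≫ g = s.inl ∧ d ≫ g = s.inr := by
    refine h.existsUnique_glue s.inl s.inr fun Z z z' hzz' ↦ ?_
    have e : z ≫ prod.map (𝟙 U) i = z' ≫ prod.map m (𝟙 Y) := by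
      rw [← hc, ← hd, reassoc_of% hzz']
    have e₁ : z ≫ prod.fst = z' ≫ prod.fst ≫ m := by simpa using congrArg (· ≫ prod.fst) e
    have e₂ : z ≫ prod.snd ≫ i = z' ≫ prod.snd := by simpa using congrArg (· ≫ prod.snd) e
    let k : Z ⟶ W ⨯ X := prod.lift (z' ≫ prod.fst) (z ≫ prod.snd)
    have hk : k ≫ prod.map m (𝟙 X) = z := by ext <;> simp [k, e₁]
    have hk' : k ≫ prod.map (𝟙 W) i = z' := by ext <;> simp [k, e₂]
    rw [← hk, ← hk', Category.assoc, Category.assoc, s.condition]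
  exact ⟨⟨w⟩, ⟨PushoutCocone.IsColimit.mk w (fun s ↦ (key s).choose)
    (fun s ↦ (key s).choose_spec.1.1) (fun s ↦ (key s).choose_spec.1.2)
    (fun s g h₁ h₂ ↦ (key s).choose_spec.2 g ⟨h₁, h₂⟩)⟩⟩

/-- Extension problems along the pushout product of a monomorphism `m` and a cofibration `i` have
solutions for trivial fibrations, and for all fibrations if `i` is a weak equivalence which remains
one after taking products with the codomain and the domain of `m`. -/
lemma exists_lift_pushoutProduct [ModelCategory M] [ElementaryTopos M]
    (hM : ∀ {X Y : M} (i : X ⟶ Y), Cofibration i ↔ Mono i)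
    {U W X Y A B : M} (m : W ⟶ U) (i : X ⟶ Y) [Mono m] [Mono i] (q : A ⟶ B) [Fibration q]
    (h : WeakEquivalence q ∨
      WeakEquivalence (prod.map (𝟙 U) i) ∧ WeakEquivalence (prod.map (𝟙 W) i))
    (u : U ⨯ X ⟶ A) (v : W ⨯ Y ⟶ A) (b : U ⨯ Y ⟶ B)
    (huv : prod.map m (𝟙 X) ≫ u = prod.map (𝟙 W) i ≫ v)
    (hu : u ≫ q = prod.map (𝟙 U) i ≫ b) (hv : v ≫ q = prod.map m (𝟙 Y) ≫ b) :
    ∃ l : U ⨯ Y ⟶ A, prod.map (𝟙 U) i ≫ l = u ∧ prod.map m (𝟙 Y) ≫ l = v ∧ l ≫ q = b := by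
  obtain ⟨S, n, c, d, hn, hc, hd, sq⟩ := exists_pushoutProduct m i
  have : Cofibration n := (hM n).2 hn
  have hl : HasLiftingProperty n q := by
    obtain h | ⟨hU, hW⟩ := h
    · infer_instance
    · have : Cofibration (prod.map (𝟙 W) i) := (hM _).2 inferInstance
      have hc' : trivialCofibrations M c :=
        (trivialCofibrations M).of_isPushout sq (mem_trivialCofibrations _)
      have : WeakEquivalence c := ⟨hc'.2⟩
      have : WeakEquivalence n := by
        rw [← hc] at hU
        exact weakEquivalence_of_precomp c n
      infer_instance
  have w : sq.desc u v huv ≫ q = n ≫ b := by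
    apply sq.hom_ext
    · rw [sq.inl_desc_assoc, hu, ← Category.assoc, hc]
    · rw [sq.inr_desc_assoc, hv, ← Category.assoc, hd]
  have sq' : CommSq (sq.desc u v huv) n q b := ⟨w⟩
  exact ⟨sq'.lift, by rw [← hc, Category.assoc, sq'.fac_left, sq.inl_desc],
    by rw [← hd, Category.assoc, sq'.fac_left, sq.inr_desc], sq'.fac_right⟩

/-- Let `q : A ⟶ U ⨯ G`, `m : W ⟶ U`, and let `a : W ⨯ G ⟶ A` be a section of `q` over `W ⨯ G`.
The predicate says that `e : E ⟶ G`, with the evaluation `ev`, is the object over `G` of sections of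
`q` along the projection to `G` whose restriction to `W` is `a`: morphisms `Z ⟶ E` over `z : Z ⟶ G`
correspond to morphisms `U ⨯ Z ⟶ A` over `U ⨯ z` which restrict to `a` on `W`. -/
structure IsSectionObject [HasBinaryProducts M] {U W G A E : M} (m : W ⟶ U) (q : A ⟶ U ⨯ G)
    (a : W ⨯ G ⟶ A) (e : E ⟶ G) (ev : U ⨯ E ⟶ A) : Prop where
  ev_proj : ev ≫ q = prod.map (𝟙 U) e
  ev_restrict : prod.map m (𝟙 E) ≫ ev = prod.map (𝟙 W) e ≫ a
  universal : ∀ {Z : M} (z : Z ⟶ G) (b : U ⨯ Z ⟶ A), b ≫ q = prod.map (𝟙 U) z →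
    prod.map m (𝟙 Z) ≫ b = prod.map (𝟙 W) z ≫ a →
    ∃! s : Z ⟶ E, s ≫ e = z ∧ prod.map (𝟙 U) s ≫ ev = b

/-- Objects of sections along product projections are constructed from exponentials: `E` is the
pullback of `A ^ U ⟶ (U ⨯ G) ^ U ⨯ A ^ W` along the morphism from `G` which is given by the unit
and by the transpose of `a`. -/
lemma exists_isSectionObject [HasFiniteLimits M] [ElementaryTopos M] {U W G A : M} (m : W ⟶ U)
    (q : A ⟶ U ⨯ G) (a : W ⨯ G ⟶ A) :
    ∃ (E : M) (e : E ⟶ G) (ev : U ⨯ E ⟶ A), IsSectionObject m q a e ev := by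
  have exp (U A : M) : ∃ (P : M) (ε : U ⨯ P ⟶ A), ∀ {Z : M} (b : U ⨯ Z ⟶ A),
      ∃! h : Z ⟶ P, prod.map (𝟙 U) h ≫ ε = b := by
    have := ElementaryTopos.cartesianClosed U
    let adj := Adjunction.ofIsLeftAdjoint (prod.functor.obj U)
    refine ⟨_, adj.counit.app A, fun {Z} b ↦ ⟨adj.homEquiv Z A b, ?_, fun h hh ↦ ?_⟩⟩
    · exact (adj.homEquiv_counit (g := adj.homEquiv Z A b)).symm.trans
        ((adj.homEquiv Z A).symm_apply_apply b)
    · refine ((adj.homEquiv Z A).symm_apply_eq).1 ?_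
      exact (adj.homEquiv_counit (g := h)).trans hh
  obtain ⟨P, ε, hP⟩ := exp U A
  obtain ⟨Q, δ, hQ⟩ := exp U (U ⨯ G)
  obtain ⟨R, γ, hR⟩ := exp W A
  have extQ {Z : M} {h k : Z ⟶ Q} (e : prod.map (𝟙 U) h ≫ δ = prod.map (𝟙 U) k ≫ δ) : h = k :=
    (hQ _).unique rfl e.symm
  have extR {Z : M} {h k : Z ⟶ R} (e : prod.map (𝟙 W) h ≫ γ = prod.map (𝟙 W) k ≫ γ) : h = k :=
    (hR _).unique rfl e.symm
  obtain ⟨pQ, hpQ, -⟩ := hQ (ε ≫ q)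
  obtain ⟨pR, hpR, -⟩ := hR (prod.map m (𝟙 P) ≫ ε)
  obtain ⟨gQ, hgQ, -⟩ := hQ (𝟙 (U ⨯ G))
  obtain ⟨gR, hgR, -⟩ := hR a
  -- the conditions on `z` and `h`, in terms of the transpose of `h`
  have iffQ {Z : M} (z : Z ⟶ G) (h : Z ⟶ P) :
      h ≫ pQ = z ≫ gQ ↔ (prod.map (𝟙 U) h ≫ ε) ≫ q = prod.map (𝟙 U) z := by
    have e₁ : prod.map (𝟙 U) (h ≫ pQ) ≫ δ = (prod.map (𝟙 U) h ≫ ε) ≫ q := by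
      rw [prod.map_id_comp, Category.assoc, hpQ, Category.assoc]
    have e₂ : prod.map (𝟙 U) (z ≫ gQ) ≫ δ = prod.map (𝟙 U) z := by
      rw [prod.map_id_comp, Category.assoc, hgQ, Category.comp_id]
    exact ⟨fun e ↦ by rw [← e₁, e, e₂], fun e ↦ extQ (by rw [e₁, e₂, e])⟩
  have iffR {Z : M} (z : Z ⟶ G) (h : Z ⟶ P) :
      h ≫ pR = z ≫ gR ↔
        prod.map m (𝟙 Z) ≫ prod.map (𝟙 U) h ≫ ε = prod.map (𝟙 W) z ≫ a := by
    have e₁ : prod.map (𝟙 W) (h ≫ pR) ≫ γ = prod.map m (𝟙 Z) ≫ prod.map (𝟙 U) h ≫ ε := by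
      rw [prod.map_id_comp, Category.assoc, hpR, ← Category.assoc, ← Category.assoc, prod.map_swap]
    have e₂ : prod.map (𝟙 W) (z ≫ gR) ≫ γ = prod.map (𝟙 W) z ≫ a := by
      rw [prod.map_id_comp, Category.assoc, hgR]
    exact ⟨fun e ↦ by rw [← e₁, e, e₂], fun e ↦ extR (by rw [e₁, e₂, e])⟩
  have sq := IsPullback.of_hasPullback (prod.lift pQ pR) (prod.lift gQ gR)
  have hsq : ∀ {Z : M} (h : Z ⟶ P) (z : Z ⟶ G),
      h ≫ prod.lift pQ pR = z ≫ prod.lift gQ gR ↔ h ≫ pQ = z ≫ gQ ∧ h ≫ pR = z ≫ gR := by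
    intro Z h z
    constructor
    · intro e
      exact ⟨by simpa using congrArg (· ≫ prod.fst) e, by simpa using congrArg (· ≫ prod.snd) e⟩
    · rintro ⟨e₁, e₂⟩
      ext <;> simp [e₁, e₂]
  have hw := (hsq _ _).1 sq.w
  refine ⟨_, pullback.snd _ _, prod.map (𝟙 U) (pullback.fst _ _) ≫ ε, (iffQ _ _).1 hw.1,
    (iffR _ _).1 hw.2, fun {Z} z b h₁ h₂ ↦ ?_⟩
  obtain ⟨h, rfl, -⟩ := hP b
  refine ⟨sq.lift h z ((hsq h z).2 ⟨(iffQ z h).2 h₁, (iffR z h).2 h₂⟩),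
    ⟨sq.lift_snd _ _ _, ?_⟩, fun s hs ↦ sq.hom_ext ?_ ?_⟩
  · rw [← Category.assoc, ← prod.map_id_comp, sq.lift_fst]
  · rw [sq.lift_fst]
    refine (hP _).unique ?_ rfl
    rw [← hs.2, prod.map_id_comp, Category.assoc]
  · rw [sq.lift_snd, hs.1]

namespace IsSectionObject

lemma hom_ext [HasBinaryProducts M] {U W G A E : M} {m : W ⟶ U} {q : A ⟶ U ⨯ G}
    {a : W ⨯ G ⟶ A} {e : E ⟶ G} {ev : U ⨯ E ⟶ A} (hE : IsSectionObject m q a e ev) {Z : M}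
    {s s' : Z ⟶ E}
    (h : s ≫ e = s' ≫ e) (h' : prod.map (𝟙 U) s ≫ ev = prod.map (𝟙 U) s' ≫ ev) : s = s' := by
  refine (hE.universal (s ≫ e) (prod.map (𝟙 U) s ≫ ev) ?_ ?_).unique ⟨rfl, rfl⟩ ⟨h.symm, h'.symm⟩
  · rw [Category.assoc, hE.ev_proj, ← prod.map_id_comp]
  · rw [← Category.assoc, ← prod.map_swap, Category.assoc, hE.ev_restrict, ← Category.assoc,
      ← prod.map_id_comp]

/-- Objects of sections are stable under base change: a pullback square from `q'` to `q` which is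
compatible with the given partial sections induces a pullback square of objects of sections. -/
lemma exists_isPullback [HasBinaryProducts M] {U W G A E G' A' E' : M} {m : W ⟶ U} {q : A ⟶ U ⨯ G}
    {a : W ⨯ G ⟶ A} {e : E ⟶ G} {ev : U ⨯ E ⟶ A} (hE : IsSectionObject m q a e ev)
    {q' : A' ⟶ U ⨯ G'} {a' : W ⨯ G' ⟶ A'} {e' : E' ⟶ G'} {ev' : U ⨯ E' ⟶ A'}
    (hE' : IsSectionObject m q' a' e' ev')
    {σ : G' ⟶ G} {α : A' ⟶ A} (hα : IsPullback α q' q (prod.map (𝟙 U) σ))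
    (haα : a' ≫ α = prod.map (𝟙 W) σ ≫ a) (ha' : a' ≫ q' = prod.map m (𝟙 G')) :
    ∃ t : E' ⟶ E, IsPullback t e' e σ ∧ prod.map (𝟙 U) t ≫ ev = ev' ≫ α := by
  obtain ⟨t, ⟨ht, ht'⟩, -⟩ := hE.universal (e' ≫ σ) (ev' ≫ α)
    (by rw [Category.assoc, hα.w, ← Category.assoc, hE'.ev_proj, ← prod.map_id_comp])
    (by rw [← Category.assoc, hE'.ev_restrict, Category.assoc, haα, ← Category.assoc,
      ← prod.map_id_comp])
  have key (s : PullbackCone e σ) : ∃! l : s.pt ⟶ E', l ≫ t = s.fst ∧ l ≫ e' = s.snd := by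
    have hb : (prod.map (𝟙 U) s.fst ≫ ev) ≫ q = prod.map (𝟙 U) s.snd ≫ prod.map (𝟙 U) σ := by
      rw [Category.assoc, hE.ev_proj, ← prod.map_id_comp, ← prod.map_id_comp, s.condition]
    let b : U ⨯ s.pt ⟶ A' := hα.lift _ _ hb
    have hb₁ : b ≫ α = prod.map (𝟙 U) s.fst ≫ ev := hα.lift_fst _ _ hb
    have hb₂ : b ≫ q' = prod.map (𝟙 U) s.snd := hα.lift_snd _ _ hb
    have hb₃ : prod.map m (𝟙 s.pt) ≫ b = prod.map (𝟙 W) s.snd ≫ a' := by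
      apply hα.hom_ext
      · rw [Category.assoc, hb₁, ← Category.assoc, ← prod.map_swap, Category.assoc, hE.ev_restrict,
          Category.assoc, haα, ← Category.assoc, ← Category.assoc, ← prod.map_id_comp,
          ← prod.map_id_comp, s.condition]
      · rw [Category.assoc, hb₂, Category.assoc, ha', prod.map_swap]
    obtain ⟨l, ⟨hl, hl'⟩, -⟩ := hE'.universal s.snd b hb₂ hb₃
    refine ⟨l, ⟨hE.hom_ext ?_ ?_, hl⟩, fun k hk ↦ hE'.hom_ext (hk.2.trans hl.symm) ?_⟩
    · rw [Category.assoc, ht, ← Category.assoc, hl, s.condition]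
    · rw [prod.map_id_comp, Category.assoc, ht', ← Category.assoc, hl', hb₁]
    · rw [hl']
      apply hα.hom_ext
      · rw [Category.assoc, ← ht', ← Category.assoc, ← prod.map_id_comp, hk.1, hb₁]
      · rw [Category.assoc, hE'.ev_proj, ← prod.map_id_comp, hk.2, hb₂]
  exact ⟨t, ⟨⟨ht⟩, ⟨PullbackCone.IsLimit.mk ht (fun s ↦ (key s).choose)
    (fun s ↦ (key s).choose_spec.1.1) (fun s ↦ (key s).choose_spec.1.2)
    (fun s l h₁ h₂ ↦ (key s).choose_spec.2 l ⟨h₁, h₂⟩)⟩⟩, ht'⟩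

variable [ModelCategory M] [ElementaryTopos M] {U W G A : M} {m : W ⟶ U} {q : A ⟶ U ⨯ G}
  {a : W ⨯ G ⟶ A} {E : M} {e : E ⟶ G} {ev : U ⨯ E ⟶ A}

/-- Lifts against an object of sections are transposes of lifts of `q` along pushout products. -/
lemma hasLiftingProperty (hE : IsSectionObject m q a e ev) (ha : a ≫ q = prod.map m (𝟙 G))
    (hM : ∀ {X Y : M} (i : X ⟶ Y), Cofibration i ↔ Mono i)
    [Mono m] [Fibration q] {X Y : M} (i : X ⟶ Y) [Mono i]
    (h : WeakEquivalence q ∨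
      WeakEquivalence (prod.map (𝟙 U) i) ∧ WeakEquivalence (prod.map (𝟙 W) i)) :
    HasLiftingProperty i e where
  sq_hasLift {x y} sq := by
    obtain ⟨b, hb, hb', hbq⟩ := exists_lift_pushoutProduct hM m i q h
      (prod.map (𝟙 U) x ≫ ev) (prod.map (𝟙 W) y ≫ a) (prod.map (𝟙 U) y)
      (by rw [← Category.assoc, ← prod.map_swap, Category.assoc, hE.ev_restrict, ← Category.assoc,
        ← Category.assoc, ← prod.map_id_comp, ← prod.map_id_comp, sq.w])
      (by rw [Category.assoc, hE.ev_proj, ← prod.map_id_comp, ← prod.map_id_comp, sq.w])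
      (by rw [Category.assoc, ha, prod.map_swap])
    obtain ⟨s, ⟨hs, hs'⟩, -⟩ := hE.universal y b hbq hb'
    refine ⟨⟨⟨s, hE.hom_ext ?_ ?_, hs⟩⟩⟩
    · rw [Category.assoc, hs, sq.w]
    · rw [prod.map_id_comp, Category.assoc, hs', hb]

lemma fibration (hE : IsSectionObject m q a e ev) (ha : a ≫ q = prod.map m (𝟙 G))
    (hM : ∀ {X Y : M} (i : X ⟶ Y), Cofibration i ↔ Mono i) [Mono m] [Fibration q]
    (h : ∀ {X Y : M} (i : X ⟶ Y), Cofibration i → WeakEquivalence i →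
      WeakEquivalence (prod.map (𝟙 U) i) ∧ WeakEquivalence (prod.map (𝟙 W) i)) :
    Fibration e := by
  rw [fibration_iff, ← trivialCofibrations_rlp]
  intro X Y i hi
  have hc : Cofibration i := ⟨hi.1⟩
  have : Mono i := (hM i).1 hc
  exact hE.hasLiftingProperty ha hM i (Or.inr (h i hc ⟨hi.2⟩))

lemma trivialFibration (hE : IsSectionObject m q a e ev) (ha : a ≫ q = prod.map m (𝟙 G))
    (hM : ∀ {X Y : M} (i : X ⟶ Y), Cofibration i ↔ Mono i) [Mono m] [Fibration q]
    [WeakEquivalence q] : WeakEquivalence e := by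
  have h : trivialFibrations M e := by
    rw [← cofibrations_rlp]
    intro X Y i hi
    have : Mono i := (hM i).1 ⟨hi⟩
    exact hE.hasLiftingProperty ha hM i (Or.inl inferInstance)
  exact ⟨h.2⟩

end IsSectionObject

end Sections

/-! ### The realization of topes -/

section Realization

universe v₀ u₀ v₁ u₁ v u w' w

lemma isLimit_binaryFan_of_existsUnique {C : Type u} [Category.{v} C] {A B X : C} (f : X ⟶ A)
    (g : X ⟶ B) (h : ∀ ⦃Z : C⦄ (s : Z ⟶ A) (t : Z ⟶ B), ∃! l : Z ⟶ X, l ≫ f = s ∧ l ≫ g = t) :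
    Nonempty (IsLimit (BinaryFan.mk f g)) :=
  ⟨BinaryFan.isLimitMk (fun s ↦ (h s.fst s.snd).choose) (fun s ↦ (h s.fst s.snd).choose_spec.1.1)
    (fun s ↦ (h s.fst s.snd).choose_spec.1.2)
    (fun s k h₁ h₂ ↦ (h s.fst s.snd).choose_spec.2 k ⟨h₁, h₂⟩)⟩

lemma existsUnique_lift_of_isLimit_binaryFan {C : Type u} [Category.{v} C] {A B X : C} {f : X ⟶ A}
    {g : X ⟶ B} (h : IsLimit (BinaryFan.mk f g)) {Z : C} (s : Z ⟶ A) (t : Z ⟶ B) :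
    ∃! l : Z ⟶ X, l ≫ f = s ∧ l ≫ g = t :=
  ⟨h.lift (BinaryFan.mk s t), ⟨h.fac _ ⟨WalkingPair.left⟩, h.fac _ ⟨WalkingPair.right⟩⟩,
    fun _ hk ↦ BinaryFan.IsLimit.hom_ext h
      (hk.1.trans (h.fac (BinaryFan.mk s t) ⟨WalkingPair.left⟩).symm)
      (hk.2.trans (h.fac (BinaryFan.mk s t) ⟨WalkingPair.right⟩).symm)⟩

/-- Generalized elements of an intersection of subobjects. -/
lemma exists_factor_of_isGLB {C : Type u} [Category.{v} C] [HasPullbacks C] {A B D X Z : C}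
    {a : A ⟶ X} {b : B ⟶ X} {d : D ⟶ X} [Mono a] [Mono b] [Mono d]
    (h : IsGLB {Subobject.mk a, Subobject.mk b} (Subobject.mk d)) {s : Z ⟶ A} {t : Z ⟶ B}
    (e : s ≫ a = t ≫ b) : ∃ l : Z ⟶ D, l ≫ d = s ≫ a := by
  have h' : Subobject.mk d = Subobject.mk a ⊓ Subobject.mk b := h.unique isGLB_pair
  have hf : (Subobject.mk d).Factors (s ≫ a) := by
    rw [h', Subobject.inf_factors]
    exact ⟨(Subobject.mk_factors_iff _ _).2 ⟨s, rfl⟩,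
      (Subobject.mk_factors_iff _ _).2 ⟨t, e.symm⟩⟩
  exact (Subobject.mk_factors_iff _ _).1 hf

lemma mapSubobject_mk {C : Type u} [Category.{v} C] {D : Type w} [Category.{w'} D] (F : C ⥤ D)
    [F.PreservesMonomorphisms] {A X : C} (a : A ⟶ X) [Mono a] :
    mapSubobject F (Subobject.mk a) = Subobject.mk (F.map a) := by
  refine Subobject.mk_eq_mk_of_comm _ _ (F.mapIso (Subobject.underlyingIso a)) ?_
  rw [Functor.mapIso_hom, ← F.map_comp, Subobject.underlyingIso_hom_comp_eq_mk]

variable {T₀ : Type u₀} [Category.{v₀} T₀] {T₁ : Type u₁} [Category.{v₁} T₁] {p : T₁ ⥤ T₀}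

namespace TopeSquare

variable {V : Type u} [Category.{v} V] (m : TopeSquare p V)

/-- The monomorphism into `m₀ I` which interprets a tope over `I`. -/
def emb {I : T₀} (φ : Tope p I) : m.dom.obj φ.1 ⟶ m.m₀.obj I :=
  m.incl.app φ.1 ≫ eqToHom (congrArg m.m₀.obj φ.2)

instance {I : T₀} (φ : Tope p I) : Mono (m.emb φ) :=
  have := m.incl_mono φ.1
  mono_comp _ _

lemma sub_eq {I : T₀} (φ : Tope p I) : m.sub φ = Subobject.mk (m.emb φ) := rfl

lemma map_emb {I J : T₀} {φ : Tope p I} {ψ : Tope p J} (f : I ⟶ J) (g : φ.1 ⟶ ψ.1)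
    [h : p.IsHomLift f g] : m.dom.map g ≫ m.emb ψ = m.emb φ ≫ m.m₀.map f := by
  obtain ⟨φ, rfl⟩ := φ
  obtain ⟨ψ, rfl⟩ := ψ
  obtain rfl := IsHomLift.eq_of_isHomLift p f g
  have := m.incl.naturality g
  simp only [emb, eqToHom_refl, Category.comp_id]
  exact this

end TopeSquare

variable {V : Type u} [Category.{v} V]

lemma TheoryModel.isPullback_emb (m : TheoryModel p V) {I J : T₀} {φ : Tope p I} {ψ : Tope p J}
    (f : I ⟶ J) (g : φ.1 ⟶ ψ.1) [h : p.IsStronglyCartesian f g] :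
    IsPullback (m.dom.map g) (m.emb φ) (m.emb ψ) (m.m₀.map f) := by
  obtain ⟨φ, rfl⟩ := φ
  obtain ⟨ψ, rfl⟩ := ψ
  obtain rfl := IsHomLift.eq_of_isHomLift p f g
  simpa [TopeSquare.emb] using m.map_cartesian g h

variable [HasFiniteProducts T₀]

/-- The product of two tope contexts is the meet of their reindexings along the projections of the
product of the cube contexts, and models preserve it. -/
lemma TheoryModel.exists_product [HasPullbacks V] (m : TheoryModel p V)
    (hp : PropositionalCoherentTheory p) (Φ Ψ : T₁) :
    ∃ (X : T₁) (f : X ⟶ Φ) (g : X ⟶ Ψ), Nonempty (IsLimit (BinaryFan.mk f g)) ∧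
      Nonempty (IsLimit (BinaryFan.mk (m.dom.map f) (m.dom.map g))) := by
  have := hp.fibered
  have := hp.faithful
  have cart {J I : T₀} (h : J ⟶ I) (φ : Tope p I) :
      ∃ (φ' : Tope p J) (k : φ'.1 ⟶ φ.1), p.IsStronglyCartesian h k := by
    obtain ⟨b, k, hk⟩ := IsPreFibered.exists_isCartesian p φ.2 h
    exact ⟨⟨b, IsHomLift.domain_eq p h k⟩, k, inferInstance⟩
  let φ : Tope p (p.obj Φ) := ⟨Φ, rfl⟩
  let ψ : Tope p (p.obj Ψ) := ⟨Ψ, rfl⟩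
  obtain ⟨φ₁, a, ha⟩ := cart (prod.fst : p.obj Φ ⨯ p.obj Ψ ⟶ _) φ
  obtain ⟨ψ₁, b, hb⟩ := cart (prod.snd : p.obj Φ ⨯ p.obj Ψ ⟶ _) ψ
  obtain ⟨χ, hχ⟩ := hp.coherent.exists_meet φ₁ ψ₁
  obtain ⟨a', ha'⟩ := (hχ.1 (Set.mem_insert φ₁ {ψ₁})).some
  obtain ⟨b', hb'⟩ := (hχ.1 (Set.mem_insert_of_mem φ₁ rfl : ψ₁ ∈ ({φ₁, ψ₁} : Set _))).some
  have hf : p.IsHomLift (𝟙 _ ≫ (prod.fst : p.obj Φ ⨯ p.obj Ψ ⟶ _)) (a' ≫ a) := inferInstance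
  have hg : p.IsHomLift (𝟙 _ ≫ (prod.snd : p.obj Φ ⨯ p.obj Ψ ⟶ _)) (b' ≫ b) := inferInstance
  rw [Category.id_comp] at hf hg
  refine ⟨χ.1, a' ≫ a, b' ≫ b, isLimit_binaryFan_of_existsUnique _ _ fun Z s t ↦ ?_,
    isLimit_binaryFan_of_existsUnique _ _ fun Z s t ↦ ?_⟩
  · -- `s` and `t` say that the tope context `Z` entails the reindexings of `φ₁` and `ψ₁` along `h`,
    -- hence the reindexing of their meet
    let h : p.obj Z ⟶ p.obj Φ ⨯ p.obj Ψ := prod.lift (p.map s) (p.map t)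
    have hs : p.map s = h ≫ prod.fst := (prod.lift_fst _ _).symm
    have ht : p.map t = h ≫ prod.snd := (prod.lift_snd _ _).symm
    obtain ⟨φ₂, c, hc⟩ := cart h φ₁
    obtain ⟨ψ₂, d, hd⟩ := cart h ψ₁
    obtain ⟨χ₂, e, he⟩ := cart h χ
    have hχ₂ := hp.coherent.meet_stable h ⟨c, hc⟩ ⟨d, hd⟩ ⟨e, he⟩ hχ
    let ζ : Tope p (p.obj Z) := ⟨Z, rfl⟩
    have h₁ : ζ ≤ φ₂ := by
      let s' := Functor.IsStronglyCartesian.map p prod.fst a hs s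
      have hs' : p.IsHomLift h s' := inferInstance
      exact ⟨⟨Functor.IsStronglyCartesian.map p h c (Category.id_comp h).symm s', inferInstance⟩⟩
    have h₂ : ζ ≤ ψ₂ := by
      let t' := Functor.IsStronglyCartesian.map p prod.snd b ht t
      have ht' : p.IsHomLift h t' := inferInstance
      exact ⟨⟨Functor.IsStronglyCartesian.map p h d (Category.id_comp h).symm t', inferInstance⟩⟩
    obtain ⟨k, hk⟩ : ζ ≤ χ₂ := hχ₂.2 (by
      rintro _ (rfl | rfl)
      exacts [h₁, h₂])
    have hl : p.IsHomLift h (k ≫ e) := inferInstance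
    refine ⟨k ≫ e, ⟨?_, ?_⟩, fun l hl' ↦ ?_⟩
    · have : p.IsHomLift (p.map s) ((k ≫ e) ≫ a' ≫ a) := by rw [hs]; infer_instance
      exact p.map_injective (IsHomLift.eq_of_isHomLift p _ _).symm
    · have : p.IsHomLift (p.map t) ((k ≫ e) ≫ b' ≫ b) := by rw [ht]; infer_instance
      exact p.map_injective (IsHomLift.eq_of_isHomLift p _ _).symm
    · apply p.map_injective
      have hl₁ := congrArg p.map hl'.1
      have hl₂ := congrArg p.map hl'.2
      rw [p.map_comp, IsHomLift.fac' p (prod.fst : p.obj Φ ⨯ p.obj Ψ ⟶ _) (a' ≫ a)] at hl₁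
      rw [p.map_comp, IsHomLift.fac' p (prod.snd : p.obj Φ ⨯ p.obj Ψ ⟶ _) (b' ≫ b)] at hl₂
      rw [IsHomLift.fac' p h (k ≫ e), ← cancel_mono (eqToHom χ.2)]
      ext
      · simpa [h, prod.lift_fst] using hl₁
      · simpa [h, prod.lift_snd] using hl₂
  · -- in `V`, a pair `(s, t)` gives a generalized element `w` of `m₀ (p Φ ⨯ p Ψ)` which lies in the
    -- pullbacks of `Φ` and `Ψ`, hence in their intersection
    have := m.preservesFiniteProducts
    have hm : IsLimit (BinaryFan.mk (m.m₀.map (prod.fst : p.obj Φ ⨯ p.obj Ψ ⟶ _))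
        (m.m₀.map prod.snd)) := mapIsLimitOfPreservesOfIsLimit m.m₀ _ _ (prodIsProd _ _)
    have hφ := m.isPullback_emb (φ := φ₁) (ψ := φ) prod.fst a
    have hψ := m.isPullback_emb (φ := ψ₁) (ψ := ψ) prod.snd b
    have hM : IsGLB {Subobject.mk (m.emb φ₁), Subobject.mk (m.emb ψ₁)}
        (Subobject.mk (m.emb χ)) := m.map_meet _ _ _ hχ
    have ea : m.dom.map a' ≫ m.emb φ₁ = m.emb χ := by simpa using m.map_emb (𝟙 _) a'
    have eb : m.dom.map b' ≫ m.emb ψ₁ = m.emb χ := by simpa using m.map_emb (𝟙 _) b'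
    obtain ⟨w, ⟨hw₁, hw₂⟩, -⟩ := existsUnique_lift_of_isLimit_binaryFan hm (s ≫ m.emb φ)
      (t ≫ m.emb ψ)
    let x := hφ.lift s w hw₁.symm
    let y := hψ.lift t w hw₂.symm
    have hx : x ≫ m.emb φ₁ = w := hφ.lift_snd _ _ _
    have hy : y ≫ m.emb ψ₁ = w := hψ.lift_snd _ _ _
    obtain ⟨l, hl⟩ := exists_factor_of_isGLB hM (hx.trans hy.symm)
    have hla : l ≫ m.dom.map a' = x := by
      rw [← cancel_mono (m.emb φ₁), Category.assoc, ea, hl]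
    have hlb : l ≫ m.dom.map b' = y := by
      rw [← cancel_mono (m.emb ψ₁), Category.assoc, eb, hl, hx, hy]
    refine ⟨l, ⟨?_, ?_⟩, fun k hk ↦ ?_⟩
    · rw [m.dom.map_comp, ← Category.assoc, hla]
      exact hφ.lift_fst _ _ _
    · rw [m.dom.map_comp, ← Category.assoc, hlb]
      exact hψ.lift_fst _ _ _
    · rw [← cancel_mono (m.emb χ), hl, hx]
      have hf' : m.dom.map (a' ≫ a) ≫ m.emb φ = m.emb χ ≫ m.m₀.map prod.fst := m.map_emb _ _
      have hg' : m.dom.map (b' ≫ b) ≫ m.emb ψ = m.emb χ ≫ m.m₀.map prod.snd := m.map_emb _ _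
      apply BinaryFan.IsLimit.hom_ext hm
      · change (k ≫ m.emb χ) ≫ m.m₀.map prod.fst = w ≫ m.m₀.map prod.fst
        rw [hw₁, Category.assoc, ← hf', ← Category.assoc, hk.1]
      · change (k ≫ m.emb χ) ≫ m.m₀.map prod.snd = w ≫ m.m₀.map prod.snd
        rw [hw₂, Category.assoc, ← hg', ← Category.assoc, hk.2]

namespace FinitaryModelCategoryWithShapes

variable {M : Type w} [Category.{w'} M] [ModelCategory M]

lemma exists_product (S : FinitaryModelCategoryWithShapes p V M) (Φ Ψ : T₁) :
    ∃ (X : T₁) (f : X ⟶ Φ) (g : X ⟶ Ψ), Nonempty (IsLimit (BinaryFan.mk f g)) :=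
  have := S.coherentCategory
  let ⟨X, f, g, h, _⟩ := S.model.exists_product S.theory Φ Ψ
  ⟨X, f, g, h⟩

variable (S : FinitaryModelCategoryWithShapes p V M)

lemma isLimit_realization {Φ Ψ X : T₁} {f : X ⟶ Φ} {g : X ⟶ Ψ} (h : IsLimit (BinaryFan.mk f g)) :
    Nonempty (IsLimit (BinaryFan.mk (S.realization.map f) (S.realization.map g))) := by
  have := S.coherentCategory
  have := S.ω_coherent
  obtain ⟨X', f', g', ⟨h'⟩, ⟨h''⟩⟩ := S.model.exists_product S.theory Φ Ψ
  have : PreservesLimit (pair Φ Ψ) S.model.dom :=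
    preservesLimit_of_preserves_limit_cone h' ((isLimitMapConeBinaryFanEquiv _ _ _).symm h'')
  exact ⟨mapIsLimitOfPreservesOfIsLimit S.realization _ _ h⟩

/-- The realization of `⊥` is initial. -/
lemma isInitial_realization {I : T₀} (φ : Tope p I) (h : IsBot φ) :
    Nonempty (IsInitial (S.realization.obj φ.1)) := by
  have := S.topos
  have := S.ω_coherent
  have hb := IsCoherentFunctor.map_bot (F := S.ω) _ (S.model.map_bot φ h)
  rw [TopeSquare.sub_eq, mapSubobject_mk] at hb
  let i : ⊥_ M ⟶ S.ω.obj (S.model.m₀.obj I) := initial.to _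
  have : Mono i := mono_of_isInitial initialIsInitial i
  let k := Subobject.ofMkLEMk _ _ (hb (Subobject.mk i))
  have : IsIso k := isIso_of_isInitial initialIsInitial k
  exact ⟨initialIsInitial.ofIso (asIso k).symm⟩

lemma realization_map_emb {I : T₀} {φ ψ : Tope p I} (a : φ.1 ⟶ ψ.1) [p.IsHomLift (𝟙 I) a] :
    S.realization.map a ≫ S.ω.map (S.model.emb ψ) = S.ω.map (S.model.emb φ) := by
  have := S.model.map_emb (𝟙 I) a
  rw [S.model.m₀.map_id, Category.comp_id] at this
  rw [← this, S.ω.map_comp]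
  rfl

lemma mono_realization {I : T₀} {φ ψ : Tope p I} (a : φ.1 ⟶ ψ.1) [p.IsHomLift (𝟙 I) a] :
    Mono (S.realization.map a) := by
  have := S.ω_coherent
  have : Mono (S.realization.map a ≫ S.ω.map (S.model.emb ψ)) := by
    rw [S.realization_map_emb]
    infer_instance
  exact mono_of_mono _ (S.ω.map (S.model.emb ψ))

/-- The realization of `φ ∨ ψ` is covered by those of `φ` and `ψ`. -/
lemma jointlyCovering_realization {I : T₀} {φ ψ χ : Tope p I} (h : IsLUB {φ, ψ} χ)
    (a : φ.1 ⟶ χ.1) (b : ψ.1 ⟶ χ.1) [p.IsHomLift (𝟙 I) a] [p.IsHomLift (𝟙 I) b] :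
    JointlyCovering (S.realization.map a) (S.realization.map b) := by
  have := S.ω_coherent
  have hl := IsCoherentFunctor.map_union (F := S.ω) _ _ _ (S.model.map_join φ ψ χ h)
  simp only [TopeSquare.sub_eq, mapSubobject_mk] at hl
  have ea := S.realization_map_emb a
  have eb := S.realization_map_emb b
  rintro T t _ ⟨x, hx⟩ ⟨y, hy⟩
  have hle : Subobject.mk (S.ω.map (S.model.emb χ)) ≤
      Subobject.mk (t ≫ S.ω.map (S.model.emb χ)) := by
    apply hl.2
    rintro _ (rfl | rfl)
    · exact Subobject.mk_le_mk_of_comm x (by rw [← Category.assoc, hx, ea])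
    · exact Subobject.mk_le_mk_of_comm y (by rw [← Category.assoc, hy, eb])
  have hs : Subobject.ofMkLEMk _ _ hle ≫ t = 𝟙 _ := by
    rw [← cancel_mono (S.ω.map (S.model.emb χ)), Category.assoc, Subobject.ofMkLEMk_comp]
    exact (Category.id_comp _).symm
  refine ⟨_, ?_, hs⟩
  rw [← cancel_mono t, Category.assoc]
  exact (congrArg (t ≫ ·) hs).trans ((Category.comp_id t).trans (Category.id_comp t).symm)

/-- The realization of `φ ∧ ψ` is the intersection of those of `φ` and `ψ`. -/
lemma isPullback_realization {I : T₀} {φ ψ χ θ : Tope p I} (h : IsGLB {φ, ψ} χ)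
    (a : χ.1 ⟶ φ.1) (b : χ.1 ⟶ ψ.1) (a' : φ.1 ⟶ θ.1) (b' : ψ.1 ⟶ θ.1) [p.IsHomLift (𝟙 I) a]
    [p.IsHomLift (𝟙 I) b] [p.IsHomLift (𝟙 I) a'] [p.IsHomLift (𝟙 I) b'] :
    IsPullback (S.realization.map a) (S.realization.map b) (S.realization.map a')
      (S.realization.map b') := by
  have := S.ω_coherent
  have := S.coherentCategory
  have e {φ ψ : Tope p I} (f : φ.1 ⟶ ψ.1) [p.IsHomLift (𝟙 I) f] :
      S.model.dom.map f ≫ S.model.emb ψ = S.model.emb φ := by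
    simpa using S.model.map_emb (𝟙 I) f
  have w : S.model.dom.map a ≫ S.model.dom.map a' = S.model.dom.map b ≫ S.model.dom.map b' := by
    rw [← cancel_mono (S.model.emb θ), Category.assoc, Category.assoc, e, e, e, e]
  have key (s : PullbackCone (S.model.dom.map a') (S.model.dom.map b')) :
      ∃ l, l ≫ S.model.emb χ = s.fst ≫ S.model.emb φ := by
    have hs : s.fst ≫ S.model.emb φ = s.snd ≫ S.model.emb ψ := by
      rw [← e a', ← e b', s.condition_assoc]
    have hM : IsGLB {Subobject.mk (S.model.emb φ), Subobject.mk (S.model.emb ψ)}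
        (Subobject.mk (S.model.emb χ)) := S.model.map_meet _ _ _ h
    exact exists_factor_of_isGLB hM hs
  have hV : IsPullback (S.model.dom.map a) (S.model.dom.map b) (S.model.dom.map a')
      (S.model.dom.map b') :=
    ⟨⟨w⟩, ⟨PullbackCone.IsLimit.mk w (fun s ↦ (key s).choose)
      (fun s ↦ by rw [← cancel_mono (S.model.emb φ), Category.assoc, e, (key s).choose_spec])
      (fun s ↦ by rw [← cancel_mono (S.model.emb ψ), Category.assoc, e, (key s).choose_spec,
        ← e a', ← e b', s.condition_assoc])
      (fun s k h₁ _ ↦ by rw [← cancel_mono (S.model.emb χ), (key s).choose_spec, ← h₁,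
        Category.assoc, e])⟩⟩
  exact hV.map S.ω

end FinitaryModelCategoryWithShapes

end Realization

/-! ### Contexts, shape extensions and terms in the induced comprehension category -/

section Contexts

universe v₀ u₀ v₁ u₁ v u w' w

/-- Cartesian morphisms of contexts have underlying pullback squares. -/
lemma ShapeContext.isPullback_of_isStronglyCartesian {T₁ : Type u₁} [Category.{v₁} T₁] {M : Type w}
    [Category.{w'} M] [HasPullbacks M] {R : T₁ ⥤ M} {P : MorphismProperty M}
    [P.IsStableUnderBaseChange] {Γ Δ : ShapeContext R P} (f : Γ ⟶ Δ)
    (hf : (toShape R P).IsStronglyCartesian f.shape f) :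
    IsPullback f.tot Γ.str Δ.str (R.map f.shape) := by
  let Θ : ShapeContext R P :=
    { shape := Γ.shape
      tot := pullback Δ.str (R.map f.shape)
      str := pullback.snd _ _
      mem := P.pullback_snd _ _ Δ.mem }
  let k : Θ ⟶ Δ := { shape := f.shape, tot := pullback.fst _ _, w := pullback.condition }
  have hk : IsPullback k.tot Θ.str Δ.str (R.map f.shape) := IsPullback.of_hasPullback _ _
  have hk' : (toShape R P).IsStronglyCartesian f.shape k := isStronglyCartesian k hk
  let e := Functor.IsCartesian.domainUniqueUpToIso (toShape R P) f.shape k f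
  have he : (toShape R P).IsHomLift (𝟙 Γ.shape) e.hom := inferInstance
  have hs : 𝟙 Γ.shape = e.hom.shape := eq_shape_of_isHomLift (Δ := Θ) _ e.hom he
  have hfac : e.hom ≫ k = f := Functor.IsCartesian.fac (toShape R P) f.shape k f
  let e' : Γ.tot ≅ Θ.tot :=
    { hom := e.hom.tot
      inv := e.inv.tot
      hom_inv_id := congrArg Hom.tot e.hom_inv_id
      inv_hom_id := congrArg Hom.tot e.inv_hom_id }
  have h₁ : e'.hom ≫ k.tot = f.tot := congrArg Hom.tot hfac
  have h₂ : e'.hom ≫ Θ.str = Γ.str := by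
    have hw : e.hom.tot ≫ Θ.str = Γ.str ≫ R.map e.hom.shape := e.hom.w
    rw [← hs] at hw
    exact hw.trans ((congrArg (_ ≫ ·) (R.map_id _)).trans (Category.comp_id _))
  exact IsPullback.of_iso hk e'.symm (Iso.refl _) (Iso.refl _) (Iso.refl _)
    (by simp [← h₁]) (by simp [← h₂]) (by simp) (by simp)

namespace FinitaryModelCategoryWithShapes

variable {T₀ : Type u₀} [Category.{v₀} T₀] [HasFiniteProducts T₀] {T₁ : Type u₁}
  [Category.{v₁} T₁] {p : T₁ ⥤ T₀} {V : Type u} [Category.{v} V] {M : Type w} [Category.{w'} M]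
  [ModelCategory M] {S : FinitaryModelCategoryWithShapes p V M} {P : MorphismProperty M}
  [P.IsMultiplicative] [P.IsStableUnderBaseChange] {hP : fibrations M ≤ P}

section Terms

variable {Γ Δ Δ' : ShapeContext S.realization P} (A : (S.inducedCompCat P hP).TypeIn Γ)

/-- The object of `M` which underlies a type.  It is a definition, and not a field projection, so
that rewriting in `M` does not have to unfold the induced comprehension category. -/
def tyTot : M := A.1.tot

/-- The fibration which underlies a type. -/
def projTot : tyTot A ⟶ Γ.tot := ((S.inducedCompCat P hP).proj A).tot

lemma fibration_projTot : Fibration (projTot A) := by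
  obtain ⟨A, rfl⟩ := A
  have h : projTot (S := S) (hP := hP) ⟨A, rfl⟩ = A.disp := Category.comp_id _
  rw [h]
  exact A.fib

lemma isIso_proj_shape : IsIso ((S.inducedCompCat P hP).proj A).shape := by
  obtain ⟨A, rfl⟩ := A
  have h : ((S.inducedCompCat P hP).proj ⟨A, rfl⟩).shape = 𝟙 A.base.shape := Category.comp_id _
  rw [h]
  exact IsIso.id A.base.shape

variable {A}

/-- The morphism of `M` which underlies a term. -/
def termTot (x : Δ ⟶ (S.inducedCompCat P hP).extend A) : Δ.tot ⟶ tyTot A := x.tot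

lemma termTot_comp (k : Δ' ⟶ Δ) (x : Δ ⟶ (S.inducedCompCat P hP).extend A) :
    termTot (k ≫ x) = k.tot ≫ termTot x := rfl

lemma termTot_projTot {x : Δ ⟶ (S.inducedCompCat P hP).extend A} {σ : Δ ⟶ Γ}
    (h : x ≫ (S.inducedCompCat P hP).proj A = σ) : termTot x ≫ projTot A = σ.tot :=
  congrArg ShapeContext.Hom.tot h

lemma term_ext {x y : Δ ⟶ (S.inducedCompCat P hP).extend A}
    (h : x ≫ (S.inducedCompCat P hP).proj A = y ≫ (S.inducedCompCat P hP).proj A)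
    (h' : termTot x = termTot y) : x = y := by
  have := isIso_proj_shape A
  refine ShapeContext.hom_ext ?_ h'
  have hs : x.shape ≫ ((S.inducedCompCat P hP).proj A).shape =
    y.shape ≫ ((S.inducedCompCat P hP).proj A).shape := congrArg ShapeContext.Hom.shape h
  exact (cancel_mono _).1 hs

lemma exists_term (σ : Δ ⟶ Γ) (t : Δ.tot ⟶ tyTot A) (h : t ≫ projTot A = σ.tot) :
    ∃ x : Δ ⟶ (S.inducedCompCat P hP).extend A,
      x ≫ (S.inducedCompCat P hP).proj A = σ ∧ termTot x = t := by
  obtain ⟨A, rfl⟩ := A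
  have h' : projTot (S := S) (hP := hP) ⟨A, rfl⟩ = A.disp := Category.comp_id _
  have hw : t ≫ A.disp = σ.tot := (congrArg (t ≫ ·) h'.symm).trans h
  let x : Δ ⟶ (ContextType.extension S.realization hP).obj A :=
    { shape := σ.shape
      tot := t
      w := (Category.assoc _ _ _).symm.trans ((congrArg (· ≫ A.base.str) hw).trans σ.w) }
  have hx : x ≫ (ContextType.display S.realization hP).app A = σ :=
    ShapeContext.hom_ext (Category.comp_id σ.shape) hw
  exact ⟨x, (congrArg (x ≫ ·) (Category.comp_id _)).trans hx, rfl⟩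

end Terms

section ShapeExtensions

open CompCatWithShapes

variable {Γ Δ : ShapeContext S.realization P} {φ ψ : T₁}

lemma isPullback_wk (G : (S.inducedCompCat P hP).ShapeExtension Γ ψ) :
    IsPullback G.wk.tot G.obj.str Γ.str (S.realization.map G.wk.shape) :=
  ShapeContext.isPullback_of_isStronglyCartesian G.wk G.cartesian

/-- The projection of tope contexts from a shape extension to the shape. -/
def var (G : (S.inducedCompCat P hP).ShapeExtension Γ ψ) : G.obj.shape ⟶ ψ := G.var

/-- The projection from a shape extension to the realization of the shape. -/
def varTot (G : (S.inducedCompCat P hP).ShapeExtension Γ ψ) : G.obj.tot ⟶ S.realization.obj ψ :=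
  G.obj.str ≫ S.realization.map (var G)

lemma isIso_lift_varTot_wk (G : (S.inducedCompCat P hP).ShapeExtension Γ ψ) :
    IsIso (prod.lift (varTot G) G.wk.tot) := by
  have hG := isPullback_wk G
  have hp : IsLimit (BinaryFan.mk G.wk.shape (var G)) := G.isProduct
  obtain ⟨hR⟩ := S.isLimit_realization hp
  obtain ⟨h⟩ := isLimit_binaryFan_of_existsUnique (varTot G) G.wk.tot fun Z s t ↦ by
    obtain ⟨r, ⟨hr₁, hr₂⟩, hr⟩ := existsUnique_lift_of_isLimit_binaryFan hR (t ≫ Γ.str) s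
    refine ⟨hG.lift t r hr₁.symm, ⟨?_, hG.lift_fst _ _ _⟩, fun l hl ↦ hG.hom_ext ?_ ?_⟩
    · rw [varTot, ← Category.assoc, hG.lift_snd, hr₂]
    · rw [hG.lift_fst, hl.2]
    · rw [hG.lift_snd]
      refine hr _ ⟨?_, ?_⟩
      · rw [Category.assoc, ← G.wk.w, ← Category.assoc, hl.2]
      · rw [← hl.1, varTot, Category.assoc]
  have e : prod.lift (varTot G) G.wk.tot =
      (h.conePointUniqueUpToIso (prodIsProd (S.realization.obj ψ) Γ.tot)).hom := by
    ext
    · rw [prod.lift_fst]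
      exact (h.conePointUniqueUpToIso_hom_comp (prodIsProd _ _) ⟨WalkingPair.left⟩).symm
    · rw [prod.lift_snd]
      exact (h.conePointUniqueUpToIso_hom_comp (prodIsProd _ _) ⟨WalkingPair.right⟩).symm
  rw [e]
  infer_instance

/-- The total object of a shape extension is a product with the realization of the shape. -/
noncomputable def prodIso (G : (S.inducedCompCat P hP).ShapeExtension Γ ψ) :
    G.obj.tot ≅ S.realization.obj ψ ⨯ Γ.tot :=
  have := isIso_lift_varTot_wk G
  asIso (prod.lift (varTot G) G.wk.tot)

lemma prodIso_hom (G : (S.inducedCompCat P hP).ShapeExtension Γ ψ) :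
    (prodIso G).hom = prod.lift (varTot G) G.wk.tot := rfl

/-- Substitutions into a shape extension are determined by their two components. -/
lemma shapeExtension_hom_ext (G : (S.inducedCompCat P hP).ShapeExtension Γ ψ) {x y : Δ ⟶ G.obj}
    (h₁ : x ≫ G.wk = y ≫ G.wk) (h₂ : x.shape ≫ var G = y.shape ≫ var G) : x = y := by
  have hp : IsLimit (BinaryFan.mk G.wk.shape (var G)) := G.isProduct
  have hs : x.shape = y.shape :=
    BinaryFan.IsLimit.hom_ext hp (congrArg ShapeContext.Hom.shape h₁) h₂
  refine ShapeContext.hom_ext hs ((isPullback_wk G).hom_ext (congrArg ShapeContext.Hom.tot h₁) ?_)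
  rw [x.w, y.w, hs]

lemma lift_shape_var (G : (S.inducedCompCat P hP).ShapeExtension Γ ψ) (x : Δ ⟶ Γ)
    (y : Δ.shape ⟶ ψ) : (G.lift x y).shape ≫ var G = y :=
  G.map_lift_var x y

lemma lift_tot_prodIso (G : (S.inducedCompCat P hP).ShapeExtension Γ ψ) (x : Δ ⟶ Γ)
    (y : Δ.shape ⟶ ψ) :
    (G.lift x y).tot ≫ (prodIso G).hom = prod.lift (Δ.str ≫ S.realization.map y) x.tot := by
  have h₁ : (G.lift x y).tot ≫ G.wk.tot = x.tot := congrArg ShapeContext.Hom.tot (G.lift_wk x y)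
  rw [prodIso_hom, prod.comp_lift, h₁, varTot, ← Category.assoc, (G.lift x y).w, Category.assoc,
    ← S.realization.map_comp, lift_shape_var]

lemma map_tot_prodIso (D : (S.inducedCompCat P hP).ShapeExtension Δ ψ)
    (G : (S.inducedCompCat P hP).ShapeExtension Γ ψ) (σ : Δ ⟶ Γ) :
    (D.map G σ).tot ≫ (prodIso G).hom = (prodIso D).hom ≫ prod.map (𝟙 _) σ.tot := by
  refine (lift_tot_prodIso G (D.wk ≫ σ) (var D)).trans ?_
  rw [prodIso_hom, prod.lift_map, Category.comp_id]
  rfl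

lemma incl_tot_prodIso (G : (S.inducedCompCat P hP).ShapeExtension Γ φ)
    (G' : (S.inducedCompCat P hP).ShapeExtension Γ ψ) (j : φ ⟶ ψ) :
    (G.incl G' j).tot ≫ (prodIso G').hom =
      (prodIso G).hom ≫ prod.map (S.realization.map j) (𝟙 _) := by
  refine (lift_tot_prodIso G' G.wk (var G ≫ j)).trans ?_
  rw [prodIso_hom, prod.lift_map, Category.comp_id, varTot, Category.assoc, S.realization.map_comp]

lemma nonempty_shapeExtension (Γ : ShapeContext S.realization P) (ψ : T₁) :
    Nonempty ((S.inducedCompCat P hP).ShapeExtension Γ ψ) := by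
  obtain ⟨X, f, g, ⟨h⟩⟩ := S.exists_product Γ.shape ψ
  let Θ : ShapeContext S.realization P :=
    { shape := X
      tot := pullback Γ.str (S.realization.map f)
      str := pullback.snd _ _
      mem := P.pullback_snd _ _ Γ.mem }
  let k : Θ ⟶ Γ := { shape := f, tot := pullback.fst _ _, w := pullback.condition }
  exact ⟨{ obj := Θ, wk := k, var := g, isProduct := h,
           cartesian := ShapeContext.isStronglyCartesian k (IsPullback.of_hasPullback _ _) }⟩

end ShapeExtensions

/-! ### Type eliminations for tope disjunction -/

lemma _root_.SimplicialTT.isHomLift_id_of_comp {T₀ : Type u₀} [Category.{v₀} T₀] {T₁ : Type u₁}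
    [Category.{v₁} T₁] {p : T₁ ⥤ T₀} {I : T₀} {X Y Z : T₁} (k : X ⟶ Y) (g : Y ⟶ Z)
    [hg : p.IsHomLift (𝟙 I) g] [hkg : p.IsHomLift (𝟙 I) (k ≫ g)] : p.IsHomLift (𝟙 I) k := by
  refine IsHomLift.of_fac' p (𝟙 I) k (IsHomLift.domain_eq p (𝟙 I) (k ≫ g))
    (IsHomLift.domain_eq p (𝟙 I) g) ?_
  have e := IsHomLift.fac' p (𝟙 I) (k ≫ g)
  rw [p.map_comp, IsHomLift.fac' p (𝟙 I) g] at e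
  rw [← cancel_mono (eqToHom (IsHomLift.domain_eq p (𝟙 I) g)),
    ← cancel_mono (eqToHom (IsHomLift.codomain_eq p (𝟙 I) g).symm)]
  simpa using e

/-- The tope eliminations hold because contexts over `⊥` are initial, and because a context whose
tope entails `φ ∨ ψ` is the pushout of its restrictions to `φ` and to `ψ`. -/
theorem hasTopeDisjunctionElim : (S.inducedCompCat P hP).HasTopeDisjunctionElim where
  bot_elim Γ hΓ A := by
    have := S.topos
    obtain ⟨hI⟩ := S.isInitial_realization ((S.inducedCompCat P hP).shape Γ) hΓ
    have : IsIso Γ.str := isIso_of_isInitial hI Γ.str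
    have hI' : IsInitial Γ.tot := hI.ofIso (asIso Γ.str).symm
    obtain ⟨x, hx, -⟩ := exists_term (hP := hP) (A := A) (𝟙 Γ) (hI'.to _) (hI'.hom_ext _ _)
    exact ⟨x, hx, fun y hy ↦ term_ext (hy.trans hx.symm) (hI'.hom_ext _ _)⟩
  join_elim Γ φ ψ χ α β δ hχ hle hα hβ hδ Γα Γβ Γδ gα gβ gδ kα kβ rα rβ rδ hkα hkβ A x y hx hy
      hxy := by
    have := S.topos
    have := S.theory.faithful
    have hlub : IsLUB {α, β} ((S.inducedCompCat P hP).shape Γ) := by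
      refine S.theory.coherent.distrib hχ ⟨?_, fun θ hθ ↦ hθ (Set.mem_insert _ _)⟩ hα hβ
      rintro _ (rfl | rfl)
      exacts [le_rfl, hle]
    -- the domains of restrictions have the restricted topes as shapes by an equality, which is
    -- eliminated to have `gα`, `gβ`, `kα`, `kβ` act on the topes themselves
    obtain ⟨α, hα'⟩ := α
    obtain ⟨β, hβ'⟩ := β
    obtain ⟨δ, hδ'⟩ := δ
    obtain rfl : Γα.shape = α := rα.shape_eq
    obtain rfl : Γβ.shape = β := rβ.shape_eq
    obtain rfl : Γδ.shape = δ := rδ.shape_eq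
    have va : p.IsHomLift (𝟙 (p.obj Γ.shape)) gα.shape := rα.vertical
    have vb : p.IsHomLift (𝟙 (p.obj Γ.shape)) gβ.shape := rβ.vertical
    have vd : p.IsHomLift (𝟙 (p.obj Γ.shape)) gδ.shape := rδ.vertical
    have ska : kα.shape ≫ gα.shape = gδ.shape := congrArg ShapeContext.Hom.shape hkα
    have skb : kβ.shape ≫ gβ.shape = gδ.shape := congrArg ShapeContext.Hom.shape hkβ
    have tka : kα.tot ≫ gα.tot = gδ.tot := congrArg ShapeContext.Hom.tot hkα
    have tkb : kβ.tot ≫ gβ.tot = gδ.tot := congrArg ShapeContext.Hom.tot hkβ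
    have txy : kα.tot ≫ termTot x = kβ.tot ≫ termTot y := congrArg ShapeContext.Hom.tot hxy
    have vka : p.IsHomLift (𝟙 (p.obj Γ.shape)) kα.shape := by
      have : p.IsHomLift (𝟙 (p.obj Γ.shape)) (kα.shape ≫ gα.shape) := by rwa [ska]
      exact isHomLift_id_of_comp kα.shape gα.shape
    have vkb : p.IsHomLift (𝟙 (p.obj Γ.shape)) kβ.shape := by
      have : p.IsHomLift (𝟙 (p.obj Γ.shape)) (kβ.shape ≫ gβ.shape) := by rwa [skb]
      exact isHomLift_id_of_comp kβ.shape gβ.shape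
    -- `Γ` entails `φ ∨ ψ`, so its realized shape is covered by the restrictions to `α` and `β`,
    -- and this covering is pulled back along `Γ ⟶ R Φ`
    have hR : JointlyCovering (S.realization.map gα.shape) (S.realization.map gβ.shape) :=
      S.jointlyCovering_realization (I := p.obj Γ.shape) (φ := ⟨Γα.shape, hα'⟩)
        (ψ := ⟨Γβ.shape, hβ'⟩) (χ := ⟨Γ.shape, rfl⟩) hlub gα.shape gβ.shape
    have hpb : IsPullback (S.realization.map kα.shape) (S.realization.map kβ.shape)
        (S.realization.map gα.shape) (S.realization.map gβ.shape) :=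
      S.isPullback_realization (I := p.obj Γ.shape) (φ := ⟨Γα.shape, hα'⟩)
        (ψ := ⟨Γβ.shape, hβ'⟩) (χ := ⟨Γδ.shape, hδ'⟩) (θ := ⟨Γ.shape, rfl⟩) hδ
        kα.shape kβ.shape gα.shape gβ.shape
    have pa := ShapeContext.isPullback_of_isStronglyCartesian gα rα.cartesian
    have pb := ShapeContext.isPullback_of_isStronglyCartesian gβ rβ.cartesian
    have pd := ShapeContext.isPullback_of_isStronglyCartesian gδ rδ.cartesian
    have hc : JointlyCovering gα.tot gβ.tot := hR.of_isPullback pa.flip pb.flip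
    have : Mono (S.realization.map gα.shape) := S.mono_realization (I := p.obj Γ.shape)
      (φ := ⟨Γα.shape, hα'⟩) (ψ := ⟨Γ.shape, rfl⟩) gα.shape
    have : Mono (S.realization.map gβ.shape) := S.mono_realization (I := p.obj Γ.shape)
      (φ := ⟨Γβ.shape, hβ'⟩) (ψ := ⟨Γ.shape, rfl⟩) gβ.shape
    have : Mono gα.tot :=
      (MorphismProperty.monomorphisms M).of_isPullback pa.flip ‹Mono (S.realization.map gα.shape)›
    have : Mono gβ.tot :=
      (MorphismProperty.monomorphisms M).of_isPullback pb.flip ‹Mono (S.realization.map gβ.shape)›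
    have tx : termTot x ≫ projTot A = gα.tot := termTot_projTot hx
    have ty : termTot y ≫ projTot A = gβ.tot := termTot_projTot hy
    obtain ⟨t, ⟨hta, htb⟩, ht⟩ := hc.existsUnique_glue (termTot x) (termTot y) fun W z z' hzz' ↦ by
      have e : (z ≫ Γα.str) ≫ S.realization.map gα.shape =
          (z' ≫ Γβ.str) ≫ S.realization.map gβ.shape := by
        rw [Category.assoc, Category.assoc, ← gα.w, ← gβ.w, reassoc_of% hzz']
      -- two elements with the same image in `Γ` come from an element of the restriction to `α ∧ β`
      let r := hpb.lift _ _ e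
      have hr : r ≫ S.realization.map kα.shape = z ≫ Γα.str := hpb.lift_fst _ _ e
      let l := pd.lift (z ≫ gα.tot) r (by
        rw [← ska, S.realization.map_comp, ← Category.assoc r, hr, Category.assoc, Category.assoc,
          gα.w])
      have hl : l ≫ gδ.tot = z ≫ gα.tot := pd.lift_fst _ _ _
      have hz : l ≫ kα.tot = z := by
        rw [← cancel_mono gα.tot, Category.assoc, tka, hl]
      have hz' : l ≫ kβ.tot = z' := by
        rw [← cancel_mono gβ.tot, Category.assoc, tkb, hl, hzz']
      rw [← hz, ← hz', Category.assoc, Category.assoc, txy]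
    obtain ⟨z, hz, hzt⟩ := exists_term (hP := hP) (A := A) (𝟙 Γ) t (by
      apply hc.hom_ext
      · rw [← Category.assoc, hta, tx]
        exact (Category.comp_id _).symm
      · rw [← Category.assoc, htb, ty]
        exact (Category.comp_id _).symm)
    refine ⟨z, ⟨hz, term_ext ?_ ?_, term_ext ?_ ?_⟩, fun z' hz' ↦
      term_ext (hz'.1.trans hz.symm) ?_⟩
    · rw [Category.assoc, hz, Category.comp_id, hx]
    · exact (congrArg (gα.tot ≫ ·) hzt).trans hta
    · rw [Category.assoc, hz, Category.comp_id, hy]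
    · exact (congrArg (gβ.tot ≫ ·) hzt).trans htb
    · rw [hzt]
      exact ht _ ⟨congrArg ShapeContext.Hom.tot hz'.2.1, congrArg ShapeContext.Hom.tot hz'.2.2⟩

end FinitaryModelCategoryWithShapes

end Contexts

/-! ### Extension types -/

section ExtensionTypes

universe v₀ u₀ v₁ u₁ v u w' w

open CompCatWithShapes

namespace FinitaryModelCategoryWithShapes

variable {T₀ : Type u₀} [Category.{v₀} T₀] [HasFiniteProducts T₀] {T₁ : Type u₁}
  [Category.{v₁} T₁] {p : T₁ ⥤ T₀} {V : Type u} [Category.{v} V] {M : Type w} [Category.{w'} M]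
  [ModelCategory M] {S : FinitaryModelCategoryWithShapes p V M} {P : MorphismProperty M}
  [P.IsMultiplicative] [P.IsStableUnderBaseChange] {hP : fibrations M ≤ P}

section TypeMorphisms

variable {Γ Δ Θ : ShapeContext S.realization P} {A : (S.inducedCompCat P hP).TypeIn Γ}
  {B : (S.inducedCompCat P hP).TypeIn Δ} {D : (S.inducedCompCat P hP).TypeIn Θ}

/-- The morphism of `M` which underlies a morphism of types. -/
def homTot (α : A.1 ⟶ B.1) : tyTot A ⟶ tyTot B := α.tot

lemma homTot_id : homTot (𝟙 A.1) = 𝟙 (tyTot A) := rfl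

lemma homTot_comp (α : A.1 ⟶ B.1) (β : B.1 ⟶ D.1) : homTot (α ≫ β) = homTot α ≫ homTot β := rfl

lemma termTot_ext_map (α : A.1 ⟶ B.1) (x : Θ ⟶ (S.inducedCompCat P hP).extend A) :
    termTot (A := B) (x ≫ (S.inducedCompCat P hP).ext.map α) = termTot x ≫ homTot α := rfl

lemma ext_map_proj (σ : Γ ⟶ Δ) (α : A.1 ⟶ B.1)
    [h : (S.inducedCompCat P hP).typ.IsHomLift σ α] :
    (S.inducedCompCat P hP).ext.map α ≫ (S.inducedCompCat P hP).proj B =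
      (S.inducedCompCat P hP).proj A ≫ σ := by
  obtain ⟨A, rfl⟩ := A
  obtain ⟨B, rfl⟩ := B
  obtain rfl := IsHomLift.eq_of_isHomLift (S.inducedCompCat P hP).typ σ α
  have h := (S.inducedCompCat P hP).π.naturality α
  refine Eq.trans ?_ (h.trans ?_)
  · exact congrArg (_ ≫ ·) (Category.comp_id _)
  · exact congrArg (· ≫ _) (Category.comp_id _).symm

lemma homTot_projTot (σ : Γ ⟶ Δ) (α : A.1 ⟶ B.1)
    [(S.inducedCompCat P hP).typ.IsHomLift σ α] : homTot α ≫ projTot B = projTot A ≫ σ.tot :=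
  congrArg ShapeContext.Hom.tot (ext_map_proj σ α)

lemma typ_hom_ext (σ : Γ ⟶ Δ) {α β : A.1 ⟶ B.1}
    (hα : (S.inducedCompCat P hP).typ.IsHomLift σ α)
    (hβ : (S.inducedCompCat P hP).typ.IsHomLift σ β) (h : homTot α = homTot β) : α = β := by
  obtain ⟨A, rfl⟩ := A
  obtain ⟨B, rfl⟩ := B
  have h₁ := IsHomLift.eq_of_isHomLift (S.inducedCompCat P hP).typ σ α
  have h₂ := IsHomLift.eq_of_isHomLift (S.inducedCompCat P hP).typ σ β
  exact ContextType.hom_ext (h₁.symm.trans h₂) h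

lemma exists_typ_hom (σ : Γ ⟶ Δ) (t : tyTot A ⟶ tyTot B)
    (h : t ≫ projTot B = projTot A ≫ σ.tot) :
    ∃ α : A.1 ⟶ B.1, (S.inducedCompCat P hP).typ.IsHomLift σ α ∧ homTot α = t := by
  obtain ⟨A, rfl⟩ := A
  obtain ⟨B, rfl⟩ := B
  have hA : projTot (S := S) (hP := hP) ⟨A, rfl⟩ = A.disp := Category.comp_id _
  have hB : projTot (S := S) (hP := hP) ⟨B, rfl⟩ = B.disp := Category.comp_id _
  rw [hA, hB] at h
  let α : A ⟶ B := { base := σ, tot := t, w := h }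
  exact ⟨α, ContextType.isHomLift_base α, rfl⟩

lemma isStronglyCartesian_of_isPullback (σ : Γ ⟶ Δ) (α : A.1 ⟶ B.1)
    [(S.inducedCompCat P hP).typ.IsHomLift σ α]
    (h : IsPullback (homTot α) (projTot A) (projTot B) σ.tot) :
    (S.inducedCompCat P hP).typ.IsStronglyCartesian σ α := by
  obtain ⟨A, rfl⟩ := A
  obtain ⟨B, rfl⟩ := B
  obtain rfl := IsHomLift.eq_of_isHomLift (S.inducedCompCat P hP).typ σ α
  have hA : projTot (S := S) (hP := hP) ⟨A, rfl⟩ = A.disp := Category.comp_id _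
  have hB : projTot (S := S) (hP := hP) ⟨B, rfl⟩ = B.disp := Category.comp_id _
  rw [hA, hB] at h
  exact ContextType.isStronglyCartesian α h

lemma isPullback_homTot (σ : Γ ⟶ Δ) (α : A.1 ⟶ B.1)
    [h : (S.inducedCompCat P hP).typ.IsStronglyCartesian σ α] :
    IsPullback (homTot α) (projTot A) (projTot B) σ.tot := by
  obtain ⟨A, rfl⟩ := A
  obtain ⟨B, rfl⟩ := B
  obtain rfl := IsHomLift.eq_of_isHomLift (S.inducedCompCat P hP).typ σ α
  have hA : projTot (S := S) (hP := hP) ⟨A, rfl⟩ = A.disp := Category.comp_id _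
  have hB : projTot (S := S) (hP := hP) ⟨B, rfl⟩ = B.disp := Category.comp_id _
  rw [hA, hB]
  exact ContextType.isPullback_of_isStronglyCartesian α h

end TypeMorphisms

section ShapeExtensions

variable {Γ Δ Θ : ShapeContext S.realization P} {φ ψ : T₁}

lemma shapeExtension_map_wk (D : (S.inducedCompCat P hP).ShapeExtension Δ ψ)
    (G : (S.inducedCompCat P hP).ShapeExtension Γ ψ) (σ : Δ ⟶ Γ) :
    D.map G σ ≫ G.wk = D.wk ≫ σ :=
  G.lift_wk _ _

lemma shapeExtension_map_var (D : (S.inducedCompCat P hP).ShapeExtension Δ ψ)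
    (G : (S.inducedCompCat P hP).ShapeExtension Γ ψ) (σ : Δ ⟶ Γ) :
    (D.map G σ).shape ≫ var G = var D :=
  lift_shape_var G _ _

lemma shapeExtension_incl_wk (G : (S.inducedCompCat P hP).ShapeExtension Γ φ)
    (G' : (S.inducedCompCat P hP).ShapeExtension Γ ψ) (j : φ ⟶ ψ) :
    G.incl G' j ≫ G'.wk = G.wk :=
  G'.lift_wk _ _

lemma shapeExtension_incl_var (G : (S.inducedCompCat P hP).ShapeExtension Γ φ)
    (G' : (S.inducedCompCat P hP).ShapeExtension Γ ψ) (j : φ ⟶ ψ) :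
    (G.incl G' j).shape ≫ var G' = var G ≫ j :=
  lift_shape_var G' G.wk (var G ≫ j)

lemma shapeExtension_map_comp (D : (S.inducedCompCat P hP).ShapeExtension Δ ψ)
    (G : (S.inducedCompCat P hP).ShapeExtension Γ ψ)
    (H : (S.inducedCompCat P hP).ShapeExtension Θ ψ) (σ : Δ ⟶ Γ) (τ : Γ ⟶ Θ) :
    D.map G σ ≫ G.map H τ = D.map H (σ ≫ τ) := by
  apply shapeExtension_hom_ext
  · rw [Category.assoc, shapeExtension_map_wk, ← Category.assoc, shapeExtension_map_wk,
      shapeExtension_map_wk, Category.assoc]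
  · rw [shapeExtension_map_var]
    refine (Category.assoc _ _ _).trans ?_
    rw [shapeExtension_map_var, shapeExtension_map_var]

lemma shapeExtension_incl_map (D : (S.inducedCompCat P hP).ShapeExtension Δ φ)
    (D' : (S.inducedCompCat P hP).ShapeExtension Δ ψ)
    (G : (S.inducedCompCat P hP).ShapeExtension Γ φ)
    (G' : (S.inducedCompCat P hP).ShapeExtension Γ ψ) (j : φ ⟶ ψ) (σ : Δ ⟶ Γ) :
    D.incl D' j ≫ D'.map G' σ = D.map G σ ≫ G.incl G' j := by
  apply shapeExtension_hom_ext
  · rw [Category.assoc, shapeExtension_map_wk, ← Category.assoc, shapeExtension_incl_wk,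
      Category.assoc, shapeExtension_incl_wk, shapeExtension_map_wk]
  · refine (Category.assoc _ _ _).trans (Eq.trans ?_ (Category.assoc _ _ _).symm)
    rw [shapeExtension_map_var, shapeExtension_incl_var, shapeExtension_incl_var,
      ← Category.assoc, shapeExtension_map_var]

variable {A : (S.inducedCompCat P hP).TypeIn Γ}

/-- The product decomposition of a shape extension of the extension of a context by a type. -/
noncomputable def prodIsoExt
    (G : (S.inducedCompCat P hP).ShapeExtension ((S.inducedCompCat P hP).extend A) ψ) :
    G.obj.tot ≅ S.realization.obj ψ ⨯ tyTot A :=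
  prodIso G

lemma map_proj_tot_prodIso
    (D : (S.inducedCompCat P hP).ShapeExtension ((S.inducedCompCat P hP).extend A) ψ)
    (G : (S.inducedCompCat P hP).ShapeExtension Γ ψ) :
    (D.map G ((S.inducedCompCat P hP).proj A)).tot ≫ (prodIso G).hom =
      (prodIsoExt D).hom ≫ prod.map (𝟙 _) (projTot A) :=
  map_tot_prodIso D G _

lemma map_term_tot_prodIso (D : (S.inducedCompCat P hP).ShapeExtension Δ ψ)
    (G : (S.inducedCompCat P hP).ShapeExtension ((S.inducedCompCat P hP).extend A) ψ)
    (s : Δ ⟶ (S.inducedCompCat P hP).extend A) :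
    (D.map G s).tot ≫ (prodIsoExt G).hom = (prodIso D).hom ≫ prod.map (𝟙 _) (termTot s) :=
  map_tot_prodIso D G s

lemma map_ext_map_tot_prodIso {B : (S.inducedCompCat P hP).TypeIn Δ}
    (D : (S.inducedCompCat P hP).ShapeExtension ((S.inducedCompCat P hP).extend A) ψ)
    (G : (S.inducedCompCat P hP).ShapeExtension ((S.inducedCompCat P hP).extend B) ψ)
    (α : A.1 ⟶ B.1) :
    (D.map G ((S.inducedCompCat P hP).ext.map α)).tot ≫ (prodIsoExt G).hom =
      (prodIsoExt D).hom ≫ prod.map (𝟙 _) (homTot α) :=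
  map_tot_prodIso D G _

end ShapeExtensions

section Problems

variable {I : T₀} {φ ψ : Tope p I} {j : φ ⟶ ψ}

variable (S) in
/-- The inclusion of the realizations of the shapes of an extension problem. -/
def inclTot (j : φ ⟶ ψ) : S.realization.obj φ.1 ⟶ S.realization.obj ψ.1 :=
  S.realization.map j.1

lemma mono_inclTot (j : φ ⟶ ψ) : Mono (inclTot S j) :=
  have := j.2
  S.mono_realization j.1

/-- The fibration over `U ⨯ Γ` given by the type of an extension problem, where `U` is the
realization of the larger shape. -/
noncomputable def fibTot (d : (S.inducedCompCat P hP).ExtensionProblem (I := I) j) :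
    tyTot d.A ⟶ S.realization.obj ψ.1 ⨯ d.base.tot :=
  projTot d.A ≫ (prodIso d.big).hom

/-- The partial section of `fibTot` given by the term of an extension problem. -/
noncomputable def secTot (d : (S.inducedCompCat P hP).ExtensionProblem (I := I) j) :
    S.realization.obj φ.1 ⨯ d.base.tot ⟶ tyTot d.A :=
  (prodIso d.small).inv ≫ termTot d.a

variable (d : (S.inducedCompCat P hP).ExtensionProblem (I := I) j)

lemma fibration_fibTot : Fibration (fibTot d) := by
  have := fibration_projTot d.A
  rw [fibTot]
  infer_instance

lemma prodIso_hom_secTot : (prodIso d.small).hom ≫ secTot d = termTot d.a :=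
  (prodIso d.small).hom_inv_id_assoc _

lemma secTot_fibTot : secTot d ≫ fibTot d = prod.map (inclTot S j) (𝟙 _) := by
  rw [← cancel_epi (prodIso d.small).hom, ← Category.assoc, prodIso_hom_secTot, fibTot,
    ← Category.assoc, termTot_projTot d.a_proj]
  exact incl_tot_prodIso d.small d.big j.1

variable {d}

/-- Solutions of an extension problem are sections over `U ⨯ Δ` with the given restriction. -/
lemma isSolution_iff {Δ : ShapeContext S.realization P} (σ : Δ ⟶ d.base)
    (D : (S.inducedCompCat P hP).ShapeExtension Δ ψ.1)
    (b : D.obj ⟶ (S.inducedCompCat P hP).extend d.A)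
    (hb : b ≫ (S.inducedCompCat P hP).proj d.A = D.map d.big σ)
    (t : S.realization.obj ψ.1 ⨯ Δ.tot ⟶ tyTot d.A) (ht : termTot b = (prodIso D).hom ≫ t) :
    d.IsSolution σ D b ↔
      prod.map (inclTot S j) (𝟙 _) ≫ t = prod.map (𝟙 _) σ.tot ≫ secTot d := by
  have key (D' : (S.inducedCompCat P hP).ShapeExtension Δ φ.1) :
      D'.incl D j.1 ≫ b = D'.map d.small σ ≫ d.a ↔
        prod.map (inclTot S j) (𝟙 _) ≫ t = prod.map (𝟙 _) σ.tot ≫ secTot d := by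
    have e₁ : termTot (D'.incl D j.1 ≫ b) =
        (prodIso D').hom ≫ prod.map (inclTot S j) (𝟙 _) ≫ t := by
      rw [termTot_comp, ht, ← Category.assoc, incl_tot_prodIso, Category.assoc]
      rfl
    have e₂ : termTot (D'.map d.small σ ≫ d.a) =
        (prodIso D').hom ≫ prod.map (𝟙 _) σ.tot ≫ secTot d := by
      rw [termTot_comp, ← prodIso_hom_secTot, ← Category.assoc, map_tot_prodIso, Category.assoc]
    constructor
    · intro h
      rw [← cancel_epi (prodIso D').hom, ← e₁, ← e₂, h]
    · intro h
      refine term_ext ?_ (by rw [e₁, e₂, h])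
      rw [Category.assoc, hb, Category.assoc, d.a_proj]
      exact shapeExtension_incl_map D' D d.small d.big j.1 σ
  obtain ⟨D'⟩ := nonempty_shapeExtension (hP := hP) Δ φ.1
  exact ⟨fun h ↦ (key D').1 (h.restrict D'), fun h ↦ ⟨hb, fun D' ↦ (key D').2 h⟩⟩

/-- The evaluation of an extension type, as a morphism of `M`. -/
noncomputable def evTot (X : ExtensionType d) :
    S.realization.obj ψ.1 ⨯ tyTot X.E ⟶ tyTot d.A :=
  (prodIsoExt X.dom).inv ≫ termTot X.ev

lemma termTot_ev (X : ExtensionType d) : termTot X.ev = (prodIsoExt X.dom).hom ≫ evTot X :=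
  ((prodIsoExt X.dom).hom_inv_id_assoc _).symm

variable (d) in
/-- Extension types are objects of sections. -/
lemma exists_extensionType :
    ∃ X : ExtensionType d, IsSectionObject (inclTot S j) (fibTot d) (secTot d) (projTot X.E)
      (evTot X) := by
  have := S.topos
  have := fibration_fibTot d
  have := mono_inclTot (S := S) j
  obtain ⟨E, e, ev, hE⟩ := exists_isSectionObject (inclTot S j) (fibTot d) (secTot d)
  have he : Fibration e := hE.fibration (secTot_fibTot d) S.cofibration_iff_mono
    fun i hi hi' ↦ ⟨S.ω_prod_acyclic _ i hi hi', S.ω_prod_acyclic _ i hi hi'⟩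
  obtain ⟨E', ev', hE'⟩ : ∃ (E' : (S.inducedCompCat P hP).TypeIn d.base)
      (ev' : S.realization.obj ψ.1 ⨯ tyTot E' ⟶ tyTot d.A),
      IsSectionObject (inclTot S j) (fibTot d) (secTot d) (projTot E') ev' := by
    let E' : ContextType S.realization P := ⟨d.base, E, e, he⟩
    have h : projTot (S := S) (hP := hP) ⟨E', rfl⟩ = e := Category.comp_id _
    exact ⟨⟨E', rfl⟩, ev, by
      exact Eq.mpr (congrArg (IsSectionObject (inclTot S j) (fibTot d) (secTot d) · ev) h) hE⟩
  obtain ⟨D⟩ := nonempty_shapeExtension (hP := hP) ((S.inducedCompCat P hP).extend E') ψ.1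
  obtain ⟨x, hx, hxt⟩ := exists_term (A := d.A)
    (D.map d.big ((S.inducedCompCat P hP).proj E')) ((prodIsoExt D).hom ≫ ev') (by
      rw [← cancel_mono (prodIso d.big).hom, map_proj_tot_prodIso, ← hE'.ev_proj, fibTot]
      simp only [Category.assoc])
  let X : ExtensionType d :=
    { E := E'
      dom := D
      ev := x
      ev_isSolution := (isSolution_iff _ D x hx ev' hxt).2 hE'.ev_restrict
      universal := fun {Δ} σ D' b hb ↦ by
        -- `t` is the section over `R ψ ⨯ Δ` which corresponds to `b`
        let t := (prodIso D').inv ≫ termTot b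
        have ht : termTot b = (prodIso D').hom ≫ t := ((prodIso D').hom_inv_id_assoc _).symm
        have ht' : t ≫ fibTot d = prod.map (𝟙 _) σ.tot := by
          rw [← cancel_epi (prodIso D').hom, ← map_tot_prodIso D' d.big, ← Category.assoc, ← ht,
            fibTot, ← Category.assoc, termTot_projTot hb.proj]
        obtain ⟨s₀, ⟨hs₀, hs₀'⟩, hs₀''⟩ := hE'.universal σ.tot t ht'
          ((isSolution_iff σ D' b hb.proj t ht).1 hb)
        have tot_eq (s : Δ ⟶ (S.inducedCompCat P hP).extend E') : termTot (D'.map D s ≫ x) =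
            (prodIso D').hom ≫ prod.map (𝟙 _) (termTot s) ≫ ev' := by
          rw [termTot_comp, hxt, ← Category.assoc, map_term_tot_prodIso, Category.assoc]
        obtain ⟨s, hs, hst⟩ := exists_term σ s₀ hs₀
        refine ⟨s, ⟨hs, term_ext ?_ ?_⟩, fun s' hs' ↦ term_ext (hs'.1.trans hs.symm) ?_⟩
        · rw [Category.assoc, hx, hb.proj, ← hs]
          exact shapeExtension_map_comp D' D d.big s _
        · rw [tot_eq, hst, hs₀', ht]
        · rw [hst]
          refine hs₀'' _ ⟨termTot_projTot hs'.1, ?_⟩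
          rw [← cancel_epi (prodIso D').hom, ← ht, ← tot_eq, hs'.2] }
  have hX : evTot X = ev' := by
    rw [← cancel_epi (prodIsoExt X.dom).hom, ← termTot_ev]
    exact hxt
  exact ⟨X, by rw [hX]; exact hE'⟩

/-- The morphism of extension types induced by a morphism of extension problems. -/
lemma exists_extensionType_map {d' d : (S.inducedCompCat P hP).ExtensionProblem (I := I) j}
    {X' : ExtensionType d'} {X : ExtensionType d}
    (hX' : IsSectionObject (inclTot S j) (fibTot d') (secTot d') (projTot X'.E) (evTot X'))
    (hX : IsSectionObject (inclTot S j) (fibTot d) (secTot d) (projTot X.E) (evTot X))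
    {σ : d'.base ⟶ d.base} {α : d'.A.1 ⟶ d.A.1} (h : d'.IsHom d σ α) :
    ∃ μ : X'.E.1 ⟶ X.E.1, (S.inducedCompCat P hP).typ.IsStronglyCartesian σ μ ∧
      prod.map (𝟙 _) (homTot μ) ≫ evTot X = evTot X' ≫ homTot α := by
  have := h.cartesian
  have hα := isPullback_homTot (d'.big.map d.big σ) α
  have hα' : IsPullback (homTot α) (fibTot d') (fibTot d) (prod.map (𝟙 _) σ.tot) :=
    IsPullback.of_iso hα (Iso.refl _) (Iso.refl _) (prodIso d'.big) (prodIso d.big)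
      (by simp) (by simp [fibTot]) (by simp [fibTot]) (map_tot_prodIso d'.big d.big σ)
  have ht : secTot d' ≫ homTot α = prod.map (𝟙 _) σ.tot ≫ secTot d := by
    rw [← cancel_epi (prodIso d'.small).hom, ← Category.assoc, prodIso_hom_secTot,
      ← termTot_ext_map, h.term, termTot_comp, ← prodIso_hom_secTot, ← Category.assoc,
      map_tot_prodIso, Category.assoc]
  obtain ⟨t, ht, ht'⟩ := hX.exists_isPullback hX' hα' ht (secTot_fibTot d')
  obtain ⟨μ, hμ, rfl⟩ := exists_typ_hom σ t ht.w
  exact ⟨μ, isStronglyCartesian_of_isPullback σ μ ht, ht'⟩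

/-- Morphisms of extension types which are compatible with evaluation as morphisms of `M` are
compatible with it as substitutions. -/
lemma map_ev_of_evTot {d' d : (S.inducedCompCat P hP).ExtensionProblem (I := I) j}
    {X' : ExtensionType d'} {X : ExtensionType d}
    {σ : d'.base ⟶ d.base} {α : d'.A.1 ⟶ d.A.1} (h : d'.IsHom d σ α) {μ : X'.E.1 ⟶ X.E.1}
    (hμ : (S.inducedCompCat P hP).typ.IsHomLift σ μ)
    (hμ' : prod.map (𝟙 _) (homTot μ) ≫ evTot X = evTot X' ≫ homTot α) :
    X'.dom.map X.dom ((S.inducedCompCat P hP).ext.map μ) ≫ X.ev =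
      X'.ev ≫ (S.inducedCompCat P hP).ext.map α := by
  have := h.cartesian
  refine term_ext ?_ ?_
  · rw [Category.assoc, X.ev_isSolution.proj, Category.assoc,
      ext_map_proj (d'.big.map d.big σ) α, ← Category.assoc, X'.ev_isSolution.proj]
    refine (shapeExtension_map_comp _ _ _ _ _).trans (Eq.trans ?_
      (shapeExtension_map_comp _ _ _ _ _).symm)
    rw [ext_map_proj σ μ]
  · refine (termTot_comp _ _).trans (Eq.trans ?_ (termTot_ext_map α X'.ev).symm)
    rw [termTot_ev, termTot_ev, ← Category.assoc, map_ext_map_tot_prodIso, Category.assoc, hμ',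
      Category.assoc]

/-- Morphisms into an extension type are determined by their compatibility with evaluation. -/
lemma extensionType_hom_ext {d' d : (S.inducedCompCat P hP).ExtensionProblem (I := I) j}
    {X' : ExtensionType d'} {X : ExtensionType d}
    (hX : IsSectionObject (inclTot S j) (fibTot d) (secTot d) (projTot X.E) (evTot X))
    (σ : d'.base ⟶ d.base) {μ ν : X'.E.1 ⟶ X.E.1}
    (hμ : (S.inducedCompCat P hP).typ.IsHomLift σ μ)
    (hν : (S.inducedCompCat P hP).typ.IsHomLift σ ν)
    (h : prod.map (𝟙 _) (homTot μ) ≫ evTot X = prod.map (𝟙 _) (homTot ν) ≫ evTot X) : μ = ν :=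
  typ_hom_ext σ hμ hν (hX.hom_ext (by rw [homTot_projTot σ μ, homTot_projTot σ ν]) h)

lemma map_homTot_id_evTot (X : ExtensionType d) :
    prod.map (𝟙 _) (homTot (𝟙 X.E.1)) ≫ evTot X = evTot X ≫ homTot (𝟙 d.A.1) := by
  rw [homTot_id, homTot_id, prod.map_id_id, Category.id_comp, Category.comp_id]

lemma map_homTot_comp_evTot {d'' d' d : (S.inducedCompCat P hP).ExtensionProblem (I := I) j}
    {X'' : ExtensionType d''} {X' : ExtensionType d'} {X : ExtensionType d}
    {α' : d''.A.1 ⟶ d'.A.1} {α : d'.A.1 ⟶ d.A.1} {μ' : X''.E.1 ⟶ X'.E.1} {μ : X'.E.1 ⟶ X.E.1}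
    (hμ' : prod.map (𝟙 _) (homTot μ') ≫ evTot X' = evTot X'' ≫ homTot α')
    (hμ : prod.map (𝟙 _) (homTot μ) ≫ evTot X = evTot X' ≫ homTot α) :
    prod.map (𝟙 _) (homTot (μ' ≫ μ)) ≫ evTot X = evTot X'' ≫ homTot (α' ≫ α) := by
  rw [homTot_comp, homTot_comp, prod.map_id_comp, Category.assoc, hμ, ← Category.assoc,
    hμ', Category.assoc]

variable (S P hP) in
/-- The pseudo-stable choice of extension types.  It is functorial since objects of sections are
determined by their universal property. -/
noncomputable def pseudoStableExtensionTypes :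
    (S.inducedCompCat P hP).PseudoStableExtensionTypes where
  type d := (exists_extensionType d).choose
  map h := (exists_extensionType_map (exists_extensionType _).choose_spec
    (exists_extensionType _).choose_spec h).choose
  map_cartesian h := (exists_extensionType_map (exists_extensionType _).choose_spec
    (exists_extensionType _).choose_spec h).choose_spec.1
  map_ev h := by
    have hμ := (exists_extensionType_map (exists_extensionType _).choose_spec
      (exists_extensionType _).choose_spec h).choose_spec
    exact map_ev_of_evTot h hμ.1.toIsHomLift hμ.2
  map_id {I φ ψ j d} h := by
    have hμ := (exists_extensionType_map (exists_extensionType _).choose_spec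
      (exists_extensionType _).choose_spec h).choose_spec
    refine extensionType_hom_ext (exists_extensionType d).choose_spec (𝟙 d.base) hμ.1.toIsHomLift
      (IsHomLift.id (exists_extensionType d).choose.E.2) (hμ.2.trans ?_)
    exact (map_homTot_id_evTot (exists_extensionType d).choose).symm
  map_comp {I φ ψ j d'' d' d σ' α' σ α} h' h h'' := by
    have hμ' := (exists_extensionType_map (exists_extensionType _).choose_spec
      (exists_extensionType _).choose_spec h').choose_spec
    have hμ := (exists_extensionType_map (exists_extensionType _).choose_spec
      (exists_extensionType _).choose_spec h).choose_spec
    have hμ'' := (exists_extensionType_map (exists_extensionType _).choose_spec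
      (exists_extensionType _).choose_spec h'').choose_spec
    exact extensionType_hom_ext (exists_extensionType d).choose_spec (σ' ≫ σ) hμ''.1.toIsHomLift
      (@IsHomLift.comp _ _ _ _ _ _ _ _ _ _ _ σ' σ _ _ hμ'.1.toIsHomLift hμ.1.toIsHomLift)
      (hμ''.2.trans (map_homTot_comp_evTot hμ'.2 hμ.2).symm)

end Problems

end FinitaryModelCategoryWithShapes

end ExtensionTypes

/-! ### Contractible types are trivial fibrations, and relative function extensionality -/

section Contractibility

universe v₀ u₀ v₁ u₁ v u w' w

open CompCatWithShapes

section ModelCategory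

universe t s

variable {M : Type s} [Category.{t} M] [ModelCategory M]

/-- If, for every fibration over the codomain of `r`, partial sections along `r` extend to sections,
then `r` is a trivial cofibration, since lifting problems are sections of pulled back fibrations. -/
lemma weakEquivalence_of_forall_section {A I : M} (r : A ⟶ I)
    (h : ∀ {E : M} (e : E ⟶ I) (t : A ⟶ E), Fibration e → t ≫ e = r →
      ∃ s : I ⟶ E, s ≫ e = 𝟙 I ∧ r ≫ s = t) : WeakEquivalence r := by
  have hr : (fibrations M).llp r := by
    intro X Y g hg
    have : Fibration g := ⟨hg⟩
    refine ⟨fun {t b} sq ↦ ?_⟩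
    obtain ⟨s, hs, hs'⟩ := h (pullback.snd g b) (pullback.lift t r sq.w) inferInstance
      (pullback.lift_snd _ _ _)
    refine ⟨⟨⟨s ≫ pullback.fst g b, ?_, ?_⟩⟩⟩
    · rw [← Category.assoc, hs', pullback.lift_fst]
    · rw [Category.assoc, pullback.condition, ← Category.assoc, hs, Category.id_comp]
  rw [fibrations_llp] at hr
  exact ⟨hr.2⟩

/-- A map `q` with a section `c` and a homotopy `h` from `c q` to the identity, on a path object
`I` with projections `s` and `t`, is a weak equivalence: `q` is a retract of the composite `c q`,
which is homotopic to the identity. -/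
lemma weakEquivalence_of_contraction {A G I : M} {q : A ⟶ G} {r : A ⟶ I} {s t : I ⟶ A} {c : G ⟶ A}
    {h : A ⟶ I} (hr : WeakEquivalence r) (hs : r ≫ s = 𝟙 A) (ht : r ≫ t = 𝟙 A) (hc : c ≫ q = 𝟙 G)
    (hs' : h ≫ s = q ≫ c) (ht' : h ≫ t = 𝟙 A) : WeakEquivalence q := by
  have : WeakEquivalence s := weakEquivalence_of_precomp_of_fac hs
  have : WeakEquivalence t := weakEquivalence_of_precomp_of_fac ht
  have : WeakEquivalence h := weakEquivalence_of_postcomp_of_fac ht'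
  have w : WeakEquivalence (q ≫ c) := by
    rw [← hs']
    infer_instance
  have retract : RetractArrow q (q ≫ c) :=
    { i := Arrow.homMk (𝟙 A) c (by simp)
      r := Arrow.homMk (𝟙 A) q (by simp [hc])
      retract := by ext <;> simp [hc] }
  exact ⟨MorphismProperty.of_retract retract w.mem⟩

end ModelCategory

/-- Pullback squares of contexts along a fibration over an isomorphism of tope contexts have
underlying pullback squares: the reindexed fibration carries a context structure. -/
lemma ShapeContext.isPullback_tot {T₁ : Type u₁} [Category.{v₁} T₁] {M : Type w}
    [Category.{w'} M] [ModelCategory M] {R : T₁ ⥤ M} {P : MorphismProperty M}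
    [P.IsMultiplicative] (hP : fibrations M ≤ P) {Y' Y Δ Γ : ShapeContext R P} {yf : Y' ⟶ Y}
    {ys : Y' ⟶ Δ} {y : Y ⟶ Γ} {σ : Δ ⟶ Γ} (h : IsPullback yf ys y σ) [Fibration y.tot]
    [IsIso y.shape] : IsPullback yf.tot ys.tot y.tot σ.tot := by
  let W : ShapeContext R P :=
    { shape := Δ.shape
      tot := pullback y.tot σ.tot
      str := pullback.snd _ _ ≫ Δ.str
      mem := P.comp_mem _ _ (hP _ (mem_fibrations _)) Δ.mem }
  let wf : W ⟶ Y :=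
    { shape := σ.shape ≫ inv y.shape
      tot := pullback.fst _ _
      w := by
        have e : Y.str = y.tot ≫ Γ.str ≫ R.map (inv y.shape) := by
          rw [← Category.assoc, y.w, Category.assoc, ← R.map_comp, IsIso.hom_inv_id, R.map_id,
            Category.comp_id]
        rw [e, ← Category.assoc, pullback.condition, Category.assoc, ← Category.assoc σ.tot, σ.w,
          R.map_comp, Category.assoc, Category.assoc] }
  let ws : W ⟶ Δ :=
    { shape := 𝟙 _
      tot := pullback.snd _ _
      w := by rw [R.map_id, Category.comp_id] }
  have hw : wf ≫ y = ws ≫ σ := by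
    refine ShapeContext.hom_ext ?_ pullback.condition
    change (σ.shape ≫ inv y.shape) ≫ y.shape = 𝟙 _ ≫ σ.shape
    rw [Category.assoc, IsIso.inv_hom_id, Category.comp_id, Category.id_comp]
  have hw' : yf.tot ≫ y.tot = ys.tot ≫ σ.tot := congrArg Hom.tot h.w
  have hs : yf.shape ≫ y.shape = ys.shape ≫ σ.shape := congrArg Hom.shape h.w
  let l : W ⟶ Y' := h.lift wf ws hw
  have hl₁ : l.tot ≫ yf.tot = pullback.fst _ _ := congrArg Hom.tot (h.lift_fst wf ws hw)
  have hl₂ : l.tot ≫ ys.tot = pullback.snd _ _ := congrArg Hom.tot (h.lift_snd wf ws hw)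
  let k : Y' ⟶ W :=
    { shape := ys.shape
      tot := pullback.lift yf.tot ys.tot hw'
      w := by
        change pullback.lift yf.tot ys.tot hw' ≫ pullback.snd _ _ ≫ Δ.str = _
        rw [pullback.lift_snd_assoc, ys.w] }
  have hk₁ : k ≫ wf = yf := by
    refine ShapeContext.hom_ext ?_ (pullback.lift_fst _ _ _)
    change ys.shape ≫ σ.shape ≫ inv y.shape = yf.shape
    rw [← Category.assoc, ← hs, Category.assoc, IsIso.hom_inv_id, Category.comp_id]
  have hk₂ : k ≫ ws = ys := ShapeContext.hom_ext (Category.comp_id _) (pullback.lift_snd _ _ _)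
  have hkl : k.tot ≫ l.tot = 𝟙 _ := by
    have : k ≫ l = 𝟙 _ := h.hom_ext
      (by rw [Category.assoc, h.lift_fst, hk₁, Category.id_comp])
      (by rw [Category.assoc, h.lift_snd, hk₂, Category.id_comp])
    exact congrArg Hom.tot this
  refine ⟨⟨hw'⟩, ⟨PullbackCone.IsLimit.mk hw'
    (fun s ↦ pullback.lift s.fst s.snd s.condition ≫ l.tot) (fun s ↦ ?_) (fun s ↦ ?_)
    (fun s z h₁ h₂ ↦ ?_)⟩⟩
  · rw [Category.assoc, hl₁, pullback.lift_fst]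
  · rw [Category.assoc, hl₂, pullback.lift_snd]
  · have hz : z ≫ k.tot = pullback.lift s.fst s.snd s.condition := by
      refine pullback.hom_ext ?_ ?_
      · rw [pullback.lift_fst, Category.assoc, ← h₁]
        exact congrArg (z ≫ ·) (pullback.lift_fst _ _ _)
      · rw [pullback.lift_snd, Category.assoc, ← h₂]
        exact congrArg (z ≫ ·) (pullback.lift_snd _ _ _)
    rw [← hz, Category.assoc, hkl, Category.comp_id]

namespace FinitaryModelCategoryWithShapes

variable {T₀ : Type u₀} [Category.{v₀} T₀] [HasFiniteProducts T₀] {T₁ : Type u₁}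
  [Category.{v₁} T₁] {p : T₁ ⥤ T₀} {V : Type u} [Category.{v} V] {M : Type w} [Category.{w'} M]
  [ModelCategory M] {S : FinitaryModelCategoryWithShapes p V M} {P : MorphismProperty M}
  [P.IsMultiplicative] [P.IsStableUnderBaseChange] {hP : fibrations M ≤ P}

variable (hP) in
lemma exists_type_of_fibration (Γ : ShapeContext S.realization P) {E : M} (e : E ⟶ Γ.tot)
    (he : Fibration e) :
    ∃ (A : (S.inducedCompCat P hP).TypeIn Γ) (k : tyTot A ≅ E), k.hom ≫ e = projTot A :=
  ⟨⟨⟨Γ, E, e, he⟩, rfl⟩, Iso.refl E,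
    (Category.id_comp _).trans (Category.comp_id _).symm⟩

section FromContractible

variable {Γ : ShapeContext S.realization P} {A : (S.inducedCompCat P hP).TypeIn Γ}

/-- Type elimination says that sections over reflexivity of fibrations over an identity type
extend. -/
lemma exists_extend_along_refl (i : (S.inducedCompCat P hP).IdentityType A) {E : M}
    (e : E ⟶ tyTot i.Id) (he : Fibration e) (t : tyTot A ⟶ E) (ht : t ≫ e = termTot i.refl) :
    ∃ s : tyTot i.Id ⟶ E, s ≫ e = 𝟙 _ ∧ termTot i.refl ≫ s = t := by
  obtain ⟨B, k, hk⟩ := exists_type_of_fibration hP ((S.inducedCompCat P hP).extend i.Id) e he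
  have ht₁ : (t ≫ k.inv) ≫ k.hom = t := by rw [Category.assoc, k.inv_hom_id, Category.comp_id]
  have ht₂ : (t ≫ k.inv) ≫ k.hom ≫ e = t ≫ e := by rw [← Category.assoc, ht₁]
  obtain ⟨x, hx, hx'⟩ := exists_term (A := B) i.refl (t ≫ k.inv)
    ((congrArg ((t ≫ k.inv) ≫ ·) hk.symm).trans (ht₂.trans ht))
  -- elimination without substitution suffices
  obtain ⟨z, hz, hz'⟩ := i.elim (𝟙 Γ) (𝟙 _) _ (𝟙 _) _
    (IsPullback.of_horiz_isIso ⟨by rw [Category.id_comp, Category.comp_id]⟩)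
    (IsPullback.of_horiz_isIso ⟨by rw [Category.id_comp, Category.comp_id]⟩) i.refl
    (by rw [Category.id_comp, Category.comp_id]) rfl B x hx
  have h₁ : termTot z ≫ projTot B = 𝟙 _ := termTot_projTot hz
  have h₂ : termTot i.refl ≫ termTot z = termTot x := congrArg termTot hz'
  refine ⟨termTot z ≫ k.hom, ?_, ?_⟩
  · exact (Category.assoc _ _ _).trans ((congrArg (termTot z ≫ ·) hk).trans h₁)
  · exact (Category.assoc _ _ _).symm.trans ((congrArg (· ≫ k.hom) (h₂.trans hx')).trans ht₁)

/-- Contractible types are weak equivalences. -/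
lemma weakEquivalence_projTot (h : (S.inducedCompCat P hP).IsContractible A) :
    WeakEquivalence (projTot A) := by
  obtain ⟨i, c, h, hc, h₁, h₂⟩ := h
  exact weakEquivalence_of_contraction (r := termTot i.refl)
    (weakEquivalence_of_forall_section _ fun e t he ht ↦ exists_extend_along_refl i e he t ht)
    (congrArg ShapeContext.Hom.tot i.refl_fst) (congrArg ShapeContext.Hom.tot i.refl_snd)
    (termTot_projTot hc) (congrArg ShapeContext.Hom.tot h₁) (congrArg ShapeContext.Hom.tot h₂)

end FromContractible

section ToContractible

/-- A monomorphism `r : X ⟶ Y` between trivial fibrations over `Γ` is a trivial cofibration after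
every substitution, by two-out-of-three, hence satisfies type elimination. -/
lemma isEliminator_of_trivialFibration {X Y Γ : ShapeContext S.realization P} (r : X ⟶ Y)
    (y : Y ⟶ Γ) {x : X ⟶ Γ} (hx : r ≫ y = x) [Mono r.tot] [Fibration y.tot]
    [WeakEquivalence y.tot] [IsIso y.shape] [Fibration x.tot] [WeakEquivalence x.tot]
    [IsIso x.shape] : (S.inducedCompCat P hP).IsEliminator r y := by
  intro Δ X' Y' σ xf xs yf ys hX hY r' hr' hr'' B b hb
  rw [hx] at hX
  have hX := ShapeContext.isPullback_tot hP hX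
  have hY := ShapeContext.isPullback_tot hP hY
  have w₁ : trivialFibrations M xs.tot := MorphismProperty.of_isPullback hX
    (mem_trivialFibrations x.tot)
  have w₂ : trivialFibrations M ys.tot := MorphismProperty.of_isPullback hY
    (mem_trivialFibrations y.tot)
  have : WeakEquivalence xs.tot := ⟨w₁.2⟩
  have : WeakEquivalence ys.tot := ⟨w₂.2⟩
  have e₁ : r'.tot ≫ yf.tot = xf.tot ≫ r.tot := congrArg ShapeContext.Hom.tot hr'
  have e₂ : r'.tot ≫ ys.tot = xs.tot := congrArg ShapeContext.Hom.tot hr''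
  have : WeakEquivalence r'.tot := weakEquivalence_of_postcomp_of_fac e₂
  have : Mono r'.tot := ⟨fun z z' hz ↦ hX.hom_ext
    (by rw [← cancel_mono r.tot, Category.assoc, Category.assoc, ← e₁, reassoc_of% hz])
    (by rw [← e₂, reassoc_of% hz])⟩
  have : Cofibration r'.tot := (S.cofibration_iff_mono _).2 this
  have := fibration_projTot B
  have sq : CommSq (termTot b) r'.tot (projTot B) (𝟙 _) :=
    ⟨(termTot_projTot hb).trans (Category.comp_id _).symm⟩
  obtain ⟨e, he, he'⟩ := exists_term (A := B) (𝟙 Y') sq.lift sq.fac_right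
  refine ⟨e, he, term_ext ?_ ((termTot_comp _ _).trans ((congrArg _ he').trans sq.fac_left))⟩
  rw [Category.assoc, he, hb]
  exact Category.comp_id r'

variable {Γ : ShapeContext S.realization P} (A : (S.inducedCompCat P hP).TypeIn Γ)

/-- The self-product of a type is a type. -/
lemma exists_pairs : ∃ (Q : (S.inducedCompCat P hP).TypeIn Γ)
    (f g : (S.inducedCompCat P hP).extend Q ⟶ (S.inducedCompCat P hP).extend A),
    f ≫ (S.inducedCompCat P hP).proj A = (S.inducedCompCat P hP).proj Q ∧
    IsPullback f g ((S.inducedCompCat P hP).proj A) ((S.inducedCompCat P hP).proj A) ∧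
    IsPullback (C := M) (P := tyTot Q) (termTot f) (termTot g) (projTot A) (projTot A) := by
  have := fibration_projTot A
  obtain ⟨Q, k, hk⟩ := exists_type_of_fibration hP Γ
    (pullback.fst (projTot A) (projTot A) ≫ projTot A) inferInstance
  obtain ⟨f, hf, hf'⟩ := exists_term (A := A) ((S.inducedCompCat P hP).proj Q)
    (k.hom ≫ pullback.fst _ _) ((Category.assoc _ _ _).trans hk)
  obtain ⟨g, hg, hg'⟩ := exists_term (A := A) ((S.inducedCompCat P hP).proj Q)
    (k.hom ≫ pullback.snd _ _)
    ((Category.assoc _ _ _).trans ((congrArg _ pullback.condition.symm).trans hk))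
  have h : IsPullback (C := M) (P := tyTot Q) (termTot f) (termTot g) (projTot A) (projTot A) :=
    IsPullback.of_iso (IsPullback.of_hasPullback _ _) k.symm (Iso.refl _) (Iso.refl _)
      (Iso.refl _) ((Category.comp_id _).trans ((congrArg (k.inv ≫ ·) hf').trans (by simp)).symm)
      ((Category.comp_id _).trans ((congrArg (k.inv ≫ ·) hg').trans (by simp)).symm)
      (by simp) (by simp)
  have key (s : PullbackCone ((S.inducedCompCat P hP).proj A) ((S.inducedCompCat P hP).proj A)) :
      ∃! l : s.pt ⟶ (S.inducedCompCat P hP).extend Q, l ≫ f = s.fst ∧ l ≫ g = s.snd := by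
    have w : termTot s.fst ≫ projTot A = termTot s.snd ≫ projTot A :=
      congrArg ShapeContext.Hom.tot s.condition
    have hl₁ := h.lift_fst _ _ w
    have hl₂ := h.lift_snd _ _ w
    obtain ⟨l, hl, hl'⟩ := exists_term (A := Q) (s.fst ≫ (S.inducedCompCat P hP).proj A)
      (h.lift _ _ w) ((congrArg (h.lift _ _ w ≫ ·) (termTot_projTot hf).symm).trans
        ((Category.assoc _ _ _).symm.trans (congrArg (· ≫ projTot A) hl₁)))
    refine ⟨l, ⟨term_ext ?_ ?_, term_ext ?_ ?_⟩, fun l' ⟨h₁, h₂⟩ ↦ term_ext ?_ (h.hom_ext ?_ ?_)⟩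
    · rw [Category.assoc, hf, hl]
    · rw [termTot_comp]
      exact (congrArg (· ≫ termTot f) hl').trans hl₁
    · rw [Category.assoc, hg, hl, s.condition]
    · rw [termTot_comp]
      exact (congrArg (· ≫ termTot g) hl').trans hl₂
    · rw [hl, ← h₁, Category.assoc, hf]
    · exact (congrArg termTot h₁).trans (hl₁.symm.trans (congrArg (· ≫ termTot f) hl'.symm))
    · exact (congrArg termTot h₂).trans (hl₂.symm.trans (congrArg (· ≫ termTot g) hl'.symm))
  exact ⟨Q, f, g, hf, ⟨⟨hf.trans hg.symm⟩, ⟨PullbackCone.IsLimit.mk _ (fun s ↦ (key s).choose)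
    (fun s ↦ (key s).choose_spec.1.1) (fun s ↦ (key s).choose_spec.1.2)
    (fun s l h₁ h₂ ↦ (key s).choose_spec.2 l ⟨h₁, h₂⟩)⟩⟩, h⟩

/-- A trivial fibration is contractible: the identity morphism of `A ×_Γ A`, for which any two
elements are identified in exactly one way, is an identity type, and a section is a center. -/
lemma isContractible_of_weakEquivalence (hA : WeakEquivalence (projTot A)) :
    (S.inducedCompCat P hP).IsContractible A := by
  have := S.topos
  have := fibration_projTot A
  have := isIso_proj_shape A
  obtain ⟨Q, f, g, hf, hfg, hfg'⟩ := exists_pairs A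
  obtain ⟨J, k, hk⟩ := exists_type_of_fibration hP ((S.inducedCompCat P hP).extend Q) (𝟙 _)
    inferInstance
  have hk' : IsIso (projTot J) := by
    rw [← hk]
    infer_instance
  -- a pair of terms of `A` has a term of its identity type, as `J` is isomorphic to `A ×_Γ A`
  have exists_J {Δ : ShapeContext S.realization P}
      (x y : Δ ⟶ (S.inducedCompCat P hP).extend A)
      (h : x ≫ (S.inducedCompCat P hP).proj A = y ≫ (S.inducedCompCat P hP).proj A) :
      ∃ z : Δ ⟶ (S.inducedCompCat P hP).extend J,
        z ≫ (S.inducedCompCat P hP).proj J ≫ f = x ∧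
          z ≫ (S.inducedCompCat P hP).proj J ≫ g = y := by
    obtain ⟨z, hz, -⟩ := exists_term (A := J) (hfg.lift x y h)
      ((hfg.lift x y h).tot ≫ inv (projTot J)) (by rw [Category.assoc]; simp)
    exact ⟨z, by rw [← Category.assoc, hz, hfg.lift_fst],
      by rw [← Category.assoc, hz, hfg.lift_snd]⟩
  obtain ⟨r, hr₁, hr₂⟩ := exists_J (𝟙 _) (𝟙 _) rfl
  have hE : (S.inducedCompCat P hP).IsEliminator r
      ((S.inducedCompCat P hP).proj J ≫ f ≫ (S.inducedCompCat P hP).proj A) := by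
    have hr : r ≫ (S.inducedCompCat P hP).proj J ≫ f ≫ (S.inducedCompCat P hP).proj A =
        (S.inducedCompCat P hP).proj A := by
      rw [← Category.assoc ((S.inducedCompCat P hP).proj J), ← Category.assoc, hr₁,
        Category.id_comp]
    have hr' : termTot r ≫ projTot J ≫ termTot f = 𝟙 _ := congrArg ShapeContext.Hom.tot hr₁
    have : Mono r.tot := @mono_of_mono_fac _ _ _ _ _ _ _ _ (inferInstanceAs (Mono (𝟙 _))) hr'
    have hf' : trivialFibrations M (termTot f) :=
      MorphismProperty.of_isPullback hfg'.flip (mem_trivialFibrations (projTot A))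
    have hy : trivialFibrations M (projTot J ≫ termTot f ≫ projTot A) :=
      MorphismProperty.comp_mem _ _ _ (mem_trivialFibrations (projTot J))
        (MorphismProperty.comp_mem _ _ _ hf' (mem_trivialFibrations (projTot A)))
    have hs : IsIso ((S.inducedCompCat P hP).proj J ≫
        f ≫ (S.inducedCompCat P hP).proj A).shape := by
      rw [hf]
      have h₁ := isIso_proj_shape J
      have h₂ := isIso_proj_shape Q
      exact IsIso.comp_isIso' h₁ h₂
    exact @isEliminator_of_trivialFibration _ _ _ _ _ _ _ _ _ _ _ _ _ _ _ _ _ _ _ r _ _ hr this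
      ⟨hy.1⟩ ⟨hy.2⟩ hs (fibration_projTot A) hA (isIso_proj_shape A)
  -- all objects are cofibrant, so the trivial fibration has a section
  have : Cofibration (initial.to Γ.tot) :=
    (S.cofibration_iff_mono _).2 (mono_of_isInitial initialIsInitial _)
  have sq : CommSq (initial.to (tyTot A)) (initial.to Γ.tot) (projTot A) (𝟙 _) :=
    ⟨initial.hom_ext _ _⟩
  obtain ⟨c, hc, -⟩ := exists_term (A := A) (𝟙 Γ) sq.lift sq.fac_right
  obtain ⟨h, h₁, h₂⟩ := exists_J ((S.inducedCompCat P hP).proj A ≫ c) (𝟙 _)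
    (by rw [Category.assoc, hc, Category.comp_id, Category.id_comp])
  exact ⟨⟨_, f, g, hfg, J, r, hr₁, hr₂, hE⟩, c, h, hc, h₁, h₂⟩

end ToContractible

variable (S P hP) in
/-- The fibration of a contractible type is trivial, and hence so is that of its object of
sections. -/
lemma relativeFunext_pseudoStableExtensionTypes :
    (pseudoStableExtensionTypes S P hP).RelativeFunext := by
  intro I φ ψ j d hd
  have := S.topos
  have := weakEquivalence_projTot hd
  have := fibration_fibTot d
  have := mono_inclTot (S := S) j
  have : WeakEquivalence (fibTot d) := by
    unfold fibTot
    infer_instance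
  exact isContractible_of_weakEquivalence _ ((exists_extensionType d).choose_spec.trivialFibration
    (secTot_fibTot d) S.cofibration_iff_mono)

end FinitaryModelCategoryWithShapes

end Contractibility

end SimplicialTT

theorem mainTheorem2 {T₀ : Type*} [Category T₀] [HasFiniteProducts T₀] {T₁ : Type*} [Category T₁]
    {p : T₁ ⥤ T₀} {V : Type*} [Category V] {M : Type*} [Category M] [ModelCategory M]
    (S : SimplicialTT.FinitaryModelCategoryWithShapes p V M)
    (P : MorphismProperty M) [P.IsMultiplicative] [P.IsStableUnderBaseChange]
    (hP : fibrations M ≤ P) :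
    ((S.inducedCompCat P hP).HasCoherentTopeLogic ∧
      (S.inducedCompCat P hP).HasTopeDisjunctionElim ∧
      ∃ X : (S.inducedCompCat P hP).PseudoStableExtensionTypes, X.RelativeFunext) ∧
    (Nonempty (SimplicialTT.StrictInterval p) → (S.inducedCompCat P hP).ModelsSHoTT) := by
  have h₁ : (S.inducedCompCat P hP).HasCoherentTopeLogic := S.theory.coherent
  have h₂ := S.hasTopeDisjunctionElim (P := P) (hP := hP)
  have h₃ : ∃ X : (S.inducedCompCat P hP).PseudoStableExtensionTypes, X.RelativeFunext :=
    ⟨_, S.relativeFunext_pseudoStableExtensionTypes P hP⟩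
  exact ⟨⟨h₁, h₂, h₃⟩, fun h ↦ ⟨h₁, h, h₂, h₃⟩⟩
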